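/- All multigraphs (loops and multiple edges allowed) are finite, connected, with at least one vertex and without vertices of degree one. For a multigraph $X$ let $r_X=|E_X|-|V_X|+1$ and let $\kappa_X$ be the number of spanning trees of $X$. A \emph{prime} $\mathfrak p$ of $X$ is a class, up to cyclic permutation, of closed paths of oriented edges without backtracks and tails that are not of the form $C^a$ with $C$ a closed path and $a\ge 2$; $\nu(\mathfrak p)$ is its length. Let $Y/X$ be an abelian cover of degree $d$, that is, a covering map $\pi\colon Y\to X$ of multigraphs (viewed as one-dimensional CW-complexes) whose fibres have $d$ elements, whose automorphism group $G=\mathrm{Aut}(Y/X)$ acts transitively on the fibres, and with $G$ abelian. For a prime $\mathfrak p$ of $X$ the Frobenius automorphism $\left(\frac{Y/X}{\mathfrak p}\right)\in G$ is the unique element sending the initial vertex to the terminal vertex of any lift to $Y$ of a closed path representing $\mathfrak p$. For a character $\chi\in\widehat G=\mathrm{Hom}(G,\mathbb C^\times)$ consider the formal product $$L_{Y/X}(u,\chi)=\prod_{\mathfrak p}\left(1-\chi\!\left(\left(\tfrac{Y/X}{\mathfrak p}\right)\right)u^{\nu(\mathfrak p)}\right)^{-1}\in\mathbb C[[u]].$$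 Let $e_\chi=\frac1{|G|}\sum_{\sigma\in G}\chi(\sigma)\sigma^{-1}\in\mathbb C[G]$, let $\chi_1$ be the trivial character and $e=1-e_{\chi_1}$, and let $I_G$ be the augmentation ideal of $\mathbb Z[G]$, the kernel of the ring morphism $\mathbb Z[G]\to\mathbb Z$ with $\sigma\mapsto 1$ for $\sigma\in G$. \textbf{Theorem.} For every $\chi\in\widehat G$ the product $L_{Y/X}(u,\chi)$ converges in $\mathbb C[[u]]$ and $L_{Y/X}(u,\chi)^{-1}$ is a non-zero polynomial in $u$. Let $L^*_{Y/X}(1,\chi)\in\mathbb C^\times$ be the first non-vanishing coefficient of the Taylor expansion of $L_{Y/X}(u,\chi)^{-1}$ at $u=1$, and put $$\theta^*_{Y/X}(1)=\sum_{\chi\in\widehat G}L^*_{Y/X}(1,\chi)\,e_{\overline\chi}\in\mathbb C[G].$$ Then $\theta^*_{Y/X}(1)\cdot e$ lies in $\mathbb Z[G]$, and even in $I_G$, the ideal $\theta^*_{Y/X}(1)\cdot e\cdot\mathbb Z[G]$ has finite index in $I_G$, and $$\left|I_G/\theta^*_{Y/X}(1)\cdot e\cdot\mathbb Z[G]\right|=2^{(d-1)(r_X-1)}\cdot\frac{\kappa_Y}{\kappa_X}.$$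 This includes the case in which $X$ is a cycle graph ($r_X=1$). -/

import Mathlib

/-- A multigraph with vertex set `V`, presented through its set `D` of oriented edges (loops and
multiple edges are allowed).  The involution `rev` reverses the orientation; it has no fixed point,
so every edge, loops included, has exactly two orientations.  The (unoriented) edges are the
two-element orbits `{e, rev e}`. -/
structure Multigraph (V D : Type*) where
  /-- initial vertex of an oriented edge -/
  init : D → V
  /-- the same edge with the opposite orientation -/
  rev : D → D
  rev_rev : ∀ e, rev (rev e) = e
  rev_ne : ∀ e, rev e ≠ e

namespace Multigraph

section Basic

variable {V D : Type*} (X : Multigraph V D)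

/-- Terminal vertex of an oriented edge. -/
def ter (e : D) : V := X.init (X.rev e)

/-- Two oriented edges are the same edge up to orientation. -/
def edgeSetoid : Setoid D where
  r a b := a = b ∨ a = X.rev b
  iseqv :=
    { refl := fun _ => Or.inl rfl
      symm := by
        rintro a b (rfl | rfl)
        · exact Or.inl rfl
        · exact Or.inr (X.rev_rev b).symm
      trans := by
        rintro a b c (rfl | rfl) (rfl | rfl)
        · exact Or.inl rfl
        · exact Or.inr rfl
        · exact Or.inr rfl
        · exact Or.inl (X.rev_rev c) }

/-- The set of unoriented edges. -/
def Edge : Type _ := Quotient X.edgeSetoid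

/-- The edge underlying an oriented edge. -/
def toEdge (e : D) : X.Edge := Quotient.mk X.edgeSetoid e

/-- The valency of `v`: the number of edges incident to `v`, loops counted twice. -/
noncomputable def valency (v : V) : ℕ := Nat.card {e : D // X.init e = v}

/-- `r_X = |E_X| - |V_X| + 1`. -/
noncomputable def rank : ℤ := (Nat.card X.Edge : ℤ) - (Nat.card V : ℤ) + 1

/-- `X.IsPath v p w`: the sequence `p` of oriented edges is a path from `v` to `w`
(the empty sequence is the constant path). -/
def IsPath : V → List D → V → Prop
  | v, [], w => v = w
  | v, e :: p, w => X.init e = v ∧ IsPath (X.ter e) p w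

/-- A closed path (of positive length). -/
def IsClosedPath (p : List D) : Prop := p ≠ [] ∧ ∃ v, X.IsPath v p v

/-- `X` has a vertex, and any two vertices are joined by a path. -/
def Connected : Prop := Nonempty V ∧ ∀ v w, ∃ p, X.IsPath v p w

/-- A cycle: a closed path in which no edge is repeated (independently of the orientation) and the
terminal vertices of its edges are distinct. -/
def IsCycle (p : List D) : Prop :=
  X.IsClosedPath p ∧ (p.map X.toEdge).Nodup ∧ (p.map X.ter).Nodup

/-- The edge set `T` is that of a spanning tree: the subgraph with all the vertices and the edges
in `T` is connected and contains no cycle. -/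
def IsSpanningTree (T : Set X.Edge) : Prop :=
  (∀ v w, ∃ p, X.IsPath v p w ∧ ∀ e ∈ p, X.toEdge e ∈ T) ∧
    ¬ ∃ p, X.IsCycle p ∧ ∀ e ∈ p, X.toEdge e ∈ T

/-- `κ_X`, the number of spanning trees. -/
noncomputable def numSpanningTrees : ℕ := Nat.card {T : Set X.Edge // X.IsSpanningTree T}

/-- A prime path: a closed path without backtracks and without a tail that is not a power `C ^ a`,
`a ≥ 2`, of a closed path `C`. -/
def IsPrimePath (p : List D) : Prop :=
  X.IsClosedPath p ∧
  p.IsChain (fun e e' => e' ≠ X.rev e) ∧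
  (∀ e ∈ p.head?, ∀ e' ∈ p.getLast?, e ≠ X.rev e') ∧
  ¬ ∃ (C : List D) (a : ℕ), X.IsClosedPath C ∧ 2 ≤ a ∧ p = (List.replicate a C).flatten

/-- The prime paths of `X`. -/
abbrev PrimePath : Type _ := {p : List D // X.IsPrimePath p}

/-- Prime paths are equivalent when they differ by a cyclic permutation. -/
def primeSetoid : Setoid X.PrimePath where
  r p q := p.1 ~r q.1
  iseqv :=
    { refl := fun p => List.IsRotated.refl p.1
      symm := fun h => List.IsRotated.symm h
      trans := fun h h' => List.IsRotated.trans h h' }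

/-- The primes of `X`: equivalence classes of prime paths. -/
def PrimeClass : Type _ := Quotient X.primeSetoid

/-- The length `ν(𝔭)` of a prime. -/
def PrimeClass.length {X : Multigraph V D} (P : X.PrimeClass) : ℕ :=
  Quotient.lift (s := X.primeSetoid) (fun p : X.PrimePath => p.1.length)
    (fun p q h => (show p.1 ~r q.1 from h).perm.length_eq) P

end Basic

/-- A morphism of multigraphs, on vertices and on oriented edges. -/
structure Hom {W F V D : Type*} (Y : Multigraph W F) (X : Multigraph V D) where
  onVert : W → V
  onDart : F → D
  map_init : ∀ e, X.init (onDart e) = onVert (Y.init e)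
  map_rev : ∀ e, onDart (Y.rev e) = X.rev (onDart e)

namespace Hom

open scoped PowerSeries.WithPiTopology PowerSeries Polynomial

variable {W F V D : Type*} {Y : Multigraph W F} {X : Multigraph V D} (π : Y.Hom X)

/-- `π` is a covering map: it is surjective and, for every vertex `w` of `Y`, maps the oriented
edges starting at `w` bijectively onto the oriented edges starting at `π w`. -/
def IsCovering : Prop :=
  Function.Surjective π.onVert ∧
    ∀ w, Set.BijOn π.onDart {e | Y.init e = w} {e | X.init e = π.onVert w}

/-- The covering `π` has degree `d`: all its fibres have `d` elements. -/
def HasDegree (d : ℕ) : Prop := ∀ v, Nat.card {w : W // π.onVert w = v} = d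

/-- `Aut(Y/X)`: the automorphisms of the multigraph `Y` that commute with the projection to `X`,
as pairs of a permutation of the vertices and a permutation of the oriented edges. -/
def aut : Subgroup (Equiv.Perm W × Equiv.Perm F) where
  carrier := {g | (∀ e, Y.init (g.2 e) = g.1 (Y.init e)) ∧ (∀ e, g.2 (Y.rev e) = Y.rev (g.2 e)) ∧
    (∀ w, π.onVert (g.1 w) = π.onVert w) ∧ (∀ e, π.onDart (g.2 e) = π.onDart e)}
  one_mem' := by simp
  mul_mem' := by
    rintro a b ⟨ha1, ha2, ha3, ha4⟩ ⟨hb1, hb2, hb3, hb4⟩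
    refine ⟨fun e => ?_, fun e => ?_, fun w => ?_, fun e => ?_⟩ <;> simp [*]
  inv_mem' := by
    rintro a ⟨ha1, ha2, ha3, ha4⟩
    refine ⟨fun e => ?_, fun e => ?_, fun w => ?_, fun e => ?_⟩
    · apply a.1.injective
      rw [← ha1]; simp
    · apply a.2.injective
      rw [ha2]; simp
    · rw [← ha3]; simp
    · rw [← ha4]; simp

/-- A Galois cover: a cover whose automorphism group acts transitively on every fibre. -/
def IsGalois : Prop :=
  π.IsCovering ∧ ∀ w w', π.onVert w = π.onVert w' → ∃ g ∈ π.aut, g.1 w = w'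

/-- `g` is a Frobenius automorphism at the prime `P` of `X`: some prime path in the class `P` has
a lift to `Y`, from `w` to `w'` say, with `g w = w'`. -/
def IsFrobenius (P : X.PrimeClass) (g : π.aut) : Prop :=
  ∃ p : X.PrimePath, Quotient.mk X.primeSetoid p = P ∧
    ∃ (q : List F) (w w' : W), q.map π.onDart = p.1 ∧ Y.IsPath w q w' ∧ g.1.1 w = w'

/-- The Frobenius automorphism at `P`, which is unique for an abelian cover. -/
noncomputable def frobenius (P : X.PrimeClass) : π.aut := Classical.epsilon (π.IsFrobenius P)

/-- The Euler factor `(1 - χ(Frob_P) u ^ ν(P))⁻¹` as a formal power series in `u`. -/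
noncomputable def eulerFactor (χ : π.aut →* ℂˣ) (P : X.PrimeClass) : ℂ⟦X⟧ :=
  (1 - PowerSeries.C (χ (π.frobenius P) : ℂ) * PowerSeries.X ^ P.length)⁻¹

/-- The Euler product of `χ` converges in `ℂ⟦u⟧`, coefficient by coefficient. -/
def EulerProductConverges (χ : π.aut →* ℂˣ) : Prop := Multipliable (π.eulerFactor χ)

/-- The Artin-Ihara `L`-function of `χ`, as a formal infinite product over the primes of `X`. -/
noncomputable def LFunction (χ : π.aut →* ℂˣ) : ℂ⟦X⟧ := ∏' P, π.eulerFactor χ P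

open Classical in
/-- `L*(1,χ)`: the first non-vanishing Taylor coefficient at `u = 1` of the polynomial
`L(u,χ)⁻¹`. -/
noncomputable def specialValue (χ : π.aut →* ℂˣ) : ℂ :=
  if h : ∃ Q : ℂ[X], (Q : ℂ⟦X⟧) = (π.LFunction χ)⁻¹ then
    (Polynomial.taylor 1 h.choose).trailingCoeff
  else 0

/-- The idempotent `e_χ = |G|⁻¹ ∑ σ, χ(σ) σ⁻¹` of `ℂ[G]`. -/
noncomputable def idem (χ : π.aut →* ℂˣ) : MonoidAlgebra ℂ π.aut :=
  (Nat.card π.aut : ℂ)⁻¹ • ∑ᶠ σ : π.aut, MonoidAlgebra.single σ⁻¹ (χ σ : ℂ)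

/-- `θ*(1) = ∑ χ, L*(1,χ) e_{χ̄}`; the complex conjugate of `χ` is its inverse. -/
noncomputable def theta : MonoidAlgebra ℂ π.aut :=
  ∑ᶠ χ : π.aut →* ℂˣ, π.specialValue χ • π.idem χ⁻¹

/-- The augmentation ideal `I_G` of `ℤ[G]`, the kernel of `s : ℤ[G] → ℤ`, `σ ↦ 1`. -/
noncomputable def augIdeal : Ideal (MonoidAlgebra ℤ π.aut) :=
  RingHom.ker (MonoidAlgebra.lift ℤ ℤ π.aut 1)

end Hom

end Multigraph

/-!
Write `G = Aut(Y/X)`.  A section of `π` on vertices identifies the vertices of `Y` with `V × G` and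
gives each oriented edge `e` of `X` a voltage `α e ∈ G`, with `α (rev e) = (α e)⁻¹`; the Frobenius of
a prime is the product of the voltages along it (`Voltage.frobenius_eq`).  For a character `χ`, let
`W_χ` be the edge (non-backtracking) matrix, `A_χ` the vertex adjacency matrix, both weighted by
`χ ∘ α`, let `Q` be the diagonal matrix of the valencies and `Δ_χ = Q - A_χ` the twisted Laplacian.

*The `L`-functions.*  `L(u, χ)⁻¹ = det (1 - u W_χ)` (`hasProd_euler`), because both sides have the
same logarithmic derivative: `tr (W_χ ^ m)` sums over the periodic paths of period `m` without
backtracks, and these are the shifts of the prime paths of length dividing `m`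
(`trace_edgeMatrix_pow`).  Bass's factorisation (`det_one_sub_X_smul_edgeMatrix`) gives
`det (1 - u W_χ) = (1 - u²) ^ (r - 1) * det (1 - u A_χ + u² (Q - 1))`, so that
`L*(1, χ) = (-2) ^ (r - 1) * det Δ_χ` as soon as `det Δ_χ ≠ 0`.

*Spanning trees.*  The linear coefficient of `det (t + Δ_Y)` is `|V_Y| κ_Y` by the matrix-tree
theorem, and `det (t + Δ_Y) = ∏ χ, det (t + Δ_χ)` since `Δ_Y` is a group matrix
(`det_groupMatrix`).  As `det Δ_1 = 0`, comparing linear coefficients yields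
`d κ_Y = κ_X ∏_{χ ≠ 1} det Δ_χ` (`card_mul_numSpanningTrees`); in particular `det Δ_χ ≠ 0` for
`χ ≠ 1`.

*The index.*  Hence `θ* e` is the image of `t = (-2) ^ (r - 1) det Δ`, for the Laplacian `Δ` over
`ℤ[G]` with the inverse voltages as weights, and `t` lies in the augmentation ideal.  For such `t`
one has `|G| [I_G : t ℤ[G]] = |∏_{χ ≠ 1} χ(t)|`
(`card_mul_relIndex_span_augmentation`), which is `2 ^ ((d - 1) (r - 1)) d κ_Y / κ_X`.

The condition on the valencies ensures `r ≥ 1`, unless `X` is a point, in which case `d = 1`.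
-/

open Matrix

/-! ### Derivatives of determinants -/

section DetDerivation

variable {n R A : Type*} [Fintype n] [DecidableEq n] [CommRing R] [CommRing A] [Algebra R A]

theorem Derivation.map_finset_prod {ι : Type*} [DecidableEq ι] (δ : Derivation R A A)
    (s : Finset ι) (f : ι → A) :
    δ (∏ i ∈ s, f i) = ∑ i ∈ s, (∏ j ∈ s.erase i, f j) * δ (f i) := by
  induction s using Finset.induction_on with
  | empty => simp
  | insert a s ha ih =>
    rw [Finset.prod_insert ha, Derivation.leibniz, ih, Finset.sum_insert ha,
      Finset.erase_insert ha, add_comm]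
    simp only [smul_eq_mul, Finset.mul_sum]
    congr 1
    refine Finset.sum_congr rfl fun i hi => ?_
    have hia : a ≠ i := fun h => ha (h ▸ hi)
    rw [Finset.erase_insert_of_ne hia, Finset.prod_insert (by simp [ha]), mul_assoc]

/-- Jacobi's formula for the derivative of a determinant. -/
theorem Derivation.map_det (δ : Derivation R A A) (M : Matrix n n A) :
    δ M.det = (M.adjugate * M.map δ).trace := by
  have h1 : (M.adjugate * M.map δ).trace = ∑ i, (M.updateCol i fun k => δ (M k i)).det := by
    rw [trace]
    refine Finset.sum_congr rfl fun i _ => ?_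
    rw [← cramer_apply, cramer_eq_adjugate_mulVec]
    rfl
  rw [h1, det_apply, map_sum]
  simp only [det_apply]
  rw [Finset.sum_comm]
  refine Finset.sum_congr rfl fun σ _ => ?_
  rw [Units.smul_def, map_zsmul, Derivation.map_finset_prod, Finset.smul_sum]
  refine Finset.sum_congr rfl fun i _ => ?_
  rw [Units.smul_def]
  congr 1
  rw [← Finset.mul_prod_erase _ _ (Finset.mem_univ i), updateCol_self, mul_comm]
  congr 1
  refine Finset.prod_congr rfl fun j hj => ?_
  rw [updateCol_ne (Finset.ne_of_mem_erase hj)]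

open Polynomial in
/-- The coefficient of `t` in `det (t + M)` is the trace of the adjugate of `M`. -/
theorem Matrix.coeff_one_det_X_add (M : Matrix n n A) :
    (scalar n (X : A[X]) + M.map C).det.coeff 1 = M.adjugate.trace := by
  have h := Derivation.map_det (R := A) Polynomial.derivative' (scalar n (X : A[X]) + M.map C)
  have h2 : (scalar n (X : A[X]) + M.map C).map (Polynomial.derivative' (R := A)) = 1 := by
    ext1 i j
    by_cases hij : i = j
    · subst hij; simp
    · simp [hij]
  rw [h2, mul_one] at h
  have h3 := congrArg (Polynomial.coeff · 0) h
  simp only [Polynomial.derivative'_apply, Polynomial.coeff_derivative] at h3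
  simp only [zero_add, Nat.cast_zero, mul_one] at h3
  rw [h3, Polynomial.coeff_zero_eq_eval_zero, ← coe_evalRingHom, ← AddMonoidHom.coe_coe,
    AddMonoidHom.map_trace, AddMonoidHom.coe_coe, ← RingHom.mapMatrix_apply, RingHom.map_adjugate]
  congr 2
  ext i j
  by_cases hij : i = j
  · subst hij; simp
  · simp [hij]

end DetDerivation

section LogDerivative

open PowerSeries

variable {K : Type*} [Field K]

/-- The Euler derivation `X * d/dX` of the ring of formal power series. -/
noncomputable def PowerSeries.eulerDerivation (K : Type*) [Field K] :
    Derivation K (PowerSeries K) (PowerSeries K) :=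
  (PowerSeries.X : PowerSeries K) • PowerSeries.derivative K

theorem PowerSeries.coeff_eulerDerivation (F : PowerSeries K) (n : ℕ) :
    coeff n (eulerDerivation K F) = n * coeff n F := by
  rw [eulerDerivation, Derivation.smul_apply, smul_eq_mul]
  cases n with
  | zero => simp
  | succ n => rw [coeff_succ_X_mul, coeff_derivative]; push_cast; ring

/-- A power series with constant coefficient `1` is determined up to degree `n` by its logarithmic
derivative up to degree `n`. -/
theorem PowerSeries.coeff_eq_of_eulerDerivation [CharZero K] {F F' S S' : PowerSeries K}
    (hF : coeff 0 F = 1) (hF' : coeff 0 F' = 1)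
    (h : eulerDerivation K F = F * S) (h' : eulerDerivation K F' = F' * S') (n : ℕ)
    (hS : ∀ i ≤ n, coeff i S = coeff i S') : coeff n F = coeff n F' := by
  have hS0 : coeff 0 S = 0 := by
    have := congrArg (coeff 0) h
    rw [coeff_eulerDerivation, coeff_mul] at this
    simpa [hF] using this.symm
  induction n using Nat.strong_induction_on with
  | _ n ih =>
    rcases Nat.eq_zero_or_pos n with rfl | hn
    · rw [hF, hF']
    · have e1 := congrArg (coeff n) h
      have e2 := congrArg (coeff n) h'
      rw [coeff_eulerDerivation, coeff_mul] at e1 e2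
      have : (n : K) * coeff n F = n * coeff n F' := by
        rw [e1, e2]
        refine Finset.sum_congr rfl fun p hp => ?_
        have hp' := Finset.HasAntidiagonal.mem_antidiagonal.1 hp
        rcases Nat.eq_zero_or_pos p.2 with h0 | h0
        · rw [h0, ← hS 0 (Nat.zero_le _), hS0, mul_zero, mul_zero]
        · rw [ih p.1 (by omega) (fun i hi => hS i (by omega)), hS p.2 (by omega)]
      exact mul_left_cancel₀ (by exact_mod_cast hn.ne') this

variable {n : Type*} [Fintype n] [DecidableEq n]

/-- The generating function of the traces of the positive powers of a matrix. -/
noncomputable def Matrix.tracePowSeries (W : Matrix n n K) : PowerSeries K :=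
  PowerSeries.mk fun m => if m = 0 then 0 else (W ^ m).trace

/-- `-u d/du log det (1 - u W) = ∑ tr (W ^ m) u ^ m`. -/
theorem Matrix.eulerDerivation_det_one_sub (W : Matrix n n K) :
    eulerDerivation K (1 - (PowerSeries.X : PowerSeries K) • W.map PowerSeries.C).det =
      (1 - (PowerSeries.X : PowerSeries K) • W.map PowerSeries.C).det *
        -W.tracePowSeries := by
  set M : Matrix n n (PowerSeries K) := 1 - (PowerSeries.X : PowerSeries K) • W.map PowerSeries.C
    with hM
  let S : Matrix n n (PowerSeries K) := Matrix.of fun i j => PowerSeries.mk fun m => (W ^ m) i j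
  -- `S = ∑ W ^ m u ^ m` is the inverse of `1 - u W`.
  have hSX : S = 1 + (PowerSeries.X : PowerSeries K) • (W.map PowerSeries.C * S) := by
    ext i j m
    rw [Matrix.add_apply, map_add, Matrix.smul_apply, smul_eq_mul]
    cases m with
    | zero =>
      rw [coeff_zero_X_mul, add_zero]
      by_cases h : i = j
      · subst h; simp [S]
      · simp [S, h]
    | succ m =>
      rw [coeff_succ_X_mul, mul_apply, map_sum]
      simp only [map_apply, coeff_C_mul, S, of_apply, coeff_mk, pow_succ']
      rw [mul_apply]
      by_cases h : i = j
      · subst h; simp [coeff_one]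
      · simp [h]
  have hMS : M * S = 1 := by
    rw [hM, sub_mul, one_mul, smul_mul]
    exact sub_eq_of_eq_add hSX
  have hadj : M.adjugate = M.det • S := by
    calc M.adjugate = M.adjugate * (M * S) := by rw [hMS, mul_one]
      _ = M.det • S := by rw [← mul_assoc, adjugate_mul, smul_mul, one_mul]
  have hδ : M.map (eulerDerivation K) =
      -((PowerSeries.X : PowerSeries K) • W.map PowerSeries.C) := by
    ext i j m
    rw [map_apply, coeff_eulerDerivation, hM, Matrix.sub_apply, Matrix.neg_apply, map_sub, map_neg,
      Matrix.smul_apply, map_apply, smul_eq_mul]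
    rcases m with _ | _ | m
    · simp
    · by_cases h : i = j
      · subst h; simp [coeff_one]
      · simp [h]
    · rw [show m + 1 + 1 = (m + 1) + 1 from rfl, coeff_succ_X_mul, coeff_C]
      by_cases h : i = j
      · subst h; simp [coeff_one]
      · simp [h]
  rw [Derivation.map_det, hδ, hadj, smul_mul, trace_smul, smul_eq_mul, mul_neg, trace_neg,
    Matrix.mul_smul]
  congr 2
  ext m
  rw [trace_smul, smul_eq_mul]
  cases m with
  | zero => simp [tracePowSeries]
  | succ m =>
    rw [coeff_succ_X_mul, tracePowSeries, coeff_mk, if_neg (Nat.succ_ne_zero m)]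
    simp only [trace, diag_apply, map_sum, mul_apply, map_apply, coeff_mul_C, S, of_apply, coeff_mk,
      pow_succ]

end LogDerivative

/-! ### Characters and group determinants -/

section Kronecker

/-- The determinants `det (c - A B)` and `det (c - B A)` agree up to powers of `c`. -/
theorem Matrix.det_scalar_sub_mul_comm {m n R : Type*} [Fintype m] [Fintype n] [DecidableEq m]
    [DecidableEq n] [CommRing R] (A : Matrix m n R) (B : Matrix n m R) (c : R) :
    c ^ Fintype.card n * (scalar m c - A * B).det = c ^ Fintype.card m * (scalar n c - B * A).det := by
  have h := congrArg (Polynomial.eval c) (charpoly_mul_comm' A B)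
  simpa [eval_charpoly] using h

/-- The character table of a finite abelian group is invertible. -/
theorem isUnit_characterTable {G : Type*} [CommGroup G] [Fintype G] [DecidableEq G] (e : G ≃ (G →* ℂˣ)) :
    IsUnit (Matrix.of fun g h : G => ((e h g : ℂˣ) : ℂ)) := by
  rw [← linearIndependent_cols_iff_isUnit]
  have h := linearIndependent_monoidHom G ℂ
  have hinj : Function.Injective fun k : G => (Units.coeHom ℂ).comp (e k) := by
    intro a b hab
    apply e.injective
    ext x
    exact DFunLike.congr_fun hab x
  have h2 := h.comp (fun k : G => (Units.coeHom ℂ).comp (e k)) hinj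
  have h3 : (Matrix.of fun g h : G => ((e h g : ℂˣ) : ℂ)).col =
      (fun f : G →* ℂ => (f : G → ℂ)) ∘ fun k : G => (Units.coeHom ℂ).comp (e k) := by
    ext a b
    simp [Matrix.col]
  rw [h3]
  exact h2

variable {G : Type*} [CommGroup G] [Finite G]

/-- Characters of a finite abelian group are equinumerous with its elements. -/
theorem nonempty_equiv_characters : Nonempty (G ≃ (G →* ℂˣ)) :=
  have : NeZero (Monoid.exponent G) := ⟨Monoid.exponent_ne_zero_of_finite⟩
  ⟨(CommGroup.monoidHom_mulEquiv_of_hasEnoughRootsOfUnity G ℂ).some.toEquiv.symm⟩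

instance finite_characters : Finite (G →* ℂˣ) :=
  .of_equiv G (nonempty_equiv_characters (G := G)).some

theorem card_characters : Nat.card (G →* ℂˣ) = Nat.card G :=
  (Nat.card_congr (nonempty_equiv_characters (G := G)).some).symm

/-- The group determinant: a block matrix whose `(g, h)` block depends on `g⁻¹ * h` only is block
diagonalised by the characters. -/
theorem det_groupMatrix {V R : Type*} [Fintype V] [DecidableEq V] [Fintype G] [DecidableEq G]
    [Fintype (G →* ℂˣ)] [CommRing R] [Algebra ℂ R] (K : G → Matrix V V R) :
    (Matrix.of fun a b : V × G => K (a.2⁻¹ * b.2) a.1 b.1).det =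
      ∏ χ : G →* ℂˣ, (∑ k, algebraMap ℂ R (χ k) • K k).det := by
  obtain ⟨e⟩ := nonempty_equiv_characters (G := G)
  set C : Matrix G G ℂ := Matrix.of fun g h : G => ((e h g : ℂˣ) : ℂ)
  let U : Matrix (V × G) (V × G) R := kroneckerMap (· * ·) 1 (C.map (algebraMap ℂ R))
  have hC : IsUnit C := isUnit_characterTable e
  have hU : IsUnit U.det := by
    rw [det_kronecker, det_one, one_pow, one_mul, ← RingHom.mapMatrix_apply, ← RingHom.map_det]
    exact (((isUnit_iff_isUnit_det C).1 hC).map (algebraMap ℂ R)).pow _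
  have key : (Matrix.of fun a b : V × G => K (a.2⁻¹ * b.2) a.1 b.1) * U =
      U * blockDiagonal fun h => ∑ k, algebraMap ℂ R (e h k) • K k := by
    ext ⟨v, g⟩ ⟨w, h⟩
    have hr : ∀ f : G → R, (∀ x, x ≠ h → f x = 0) → ∑ x, f x = f h := fun f hf =>
      Finset.sum_eq_single h (fun x _ hx => hf x hx) (by simp)
    rw [mul_apply, mul_apply, Fintype.sum_prod_type, Fintype.sum_prod_type,
      Finset.sum_eq_single w (by rintro x - hx; simp [U, hx]) (by simp),
      Finset.sum_eq_single v (by rintro x - hx; simp [U, Ne.symm hx]) (by simp),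
      hr (fun x => U (v, g) (v, x) * _) (by intro x hx; simp [blockDiagonal_apply, hx])]
    simp only [of_apply, kroneckerMap_apply, U, one_apply_eq, one_mul, map_apply, C,
      blockDiagonal_apply, if_true, Matrix.sum_apply, Matrix.smul_apply, Finset.mul_sum]
    refine Fintype.sum_equiv (Equiv.mulLeft g⁻¹) _ _ fun x => ?_
    simp only [Equiv.coe_mulLeft, smul_eq_mul]
    rw [← mul_assoc, ← map_mul, ← Units.val_mul, ← map_mul, mul_inv_cancel_left, mul_comm]
  have h2 := congrArg det key
  rw [det_mul, det_mul, mul_comm U.det] at h2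
  rw [hU.mul_right_cancel h2, det_blockDiagonal]
  exact Fintype.prod_equiv e _ _ fun _ => rfl

end Kronecker

/-! ### Paths, rooted trees and spanning trees -/

namespace Multigraph

section Paths

variable {V D : Type*} (X : Multigraph V D)

theorem toEdge_eq_iff {a b : D} : X.toEdge a = X.toEdge b ↔ a = b ∨ a = X.rev b :=
  Quotient.eq (r := X.edgeSetoid)

@[simp] theorem toEdge_rev (e : D) : X.toEdge (X.rev e) = X.toEdge e :=
  X.toEdge_eq_iff.2 (Or.inr rfl)

@[simp] theorem init_rev (e : D) : X.init (X.rev e) = X.ter e := rfl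

@[simp] theorem ter_rev (e : D) : X.ter (X.rev e) = X.init e := by
  rw [ter, X.rev_rev]

variable {X}

theorem IsPath.append {v w x : V} {p q : List D} (hp : X.IsPath v p w) (hq : X.IsPath w q x) :
    X.IsPath v (p ++ q) x := by
  induction p generalizing v with
  | nil => cases hp; exact hq
  | cons e p ih => exact ⟨hp.1, ih hp.2⟩

theorem IsPath.reverse {v w : V} {p : List D} (hp : X.IsPath v p w) :
    X.IsPath w (p.map X.rev).reverse v := by
  induction p generalizing v with
  | nil => cases hp; exact rfl
  | cons e p ih =>
    rw [List.map_cons, List.reverse_cons]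
    exact (ih hp.2).append ⟨rfl, by rw [ter_rev]; exact hp.1⟩

theorem IsPath.exists_suffix {v w x : V} {p : List D} (hp : X.IsPath v p w)
    (hx : x ∈ v :: p.map X.ter) : ∃ q, q <:+ p ∧ X.IsPath x q w := by
  induction p generalizing v with
  | nil =>
    obtain rfl : x = v := by simpa using hx
    exact ⟨[], List.suffix_refl _, hp⟩
  | cons e p ih =>
    rcases List.mem_cons.1 hx with rfl | hx
    · exact ⟨_, List.suffix_refl _, hp⟩
    · obtain ⟨q, hq, hq'⟩ := ih hp.2 hx
      exact ⟨q, hq.trans (List.suffix_cons _ _), hq'⟩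

/-- A path of minimal length, among the paths with given end points and edges in `T`, does not meet
a vertex twice. -/
theorem IsPath.nodup_of_minimal {T : Set X.Edge} {v w : V} {p : List D} (hp : X.IsPath v p w)
    (hT : ∀ e ∈ p, X.toEdge e ∈ T)
    (hmin : ∀ q, X.IsPath v q w → (∀ e ∈ q, X.toEdge e ∈ T) → p.length ≤ q.length) :
    (v :: p.map X.ter).Nodup := by
  induction p generalizing v with
  | nil => simp
  | cons e p ih =>
    rw [List.nodup_cons]
    constructor
    · intro hv
      obtain ⟨q, hq, hq'⟩ := hp.2.exists_suffix hv
      have h1 := hmin q hq' fun e he => hT e (List.mem_cons_of_mem _ (hq.subset he))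
      have h2 := hq.length_le
      simp only [List.length_cons] at h1
      omega
    · refine ih hp.2 (fun a ha => hT a (List.mem_cons_of_mem _ ha)) fun q hq hqT => ?_
      have := hmin (e :: q) ⟨hp.1, hq⟩ (by
        intro a ha
        rcases List.mem_cons.1 ha with rfl | ha
        · exact hT a List.mem_cons_self
        · exact hqT a ha)
      simpa using this

theorem IsPath.nodup_toEdge {v w : V} {p : List D} (hp : X.IsPath v p w)
    (h : (v :: p.map X.ter).Nodup) : (p.map X.toEdge).Nodup := by
  induction p generalizing v with
  | nil => simp
  | cons e p ih =>
    have h' := List.nodup_cons.1 h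
    rw [List.map_cons, List.nodup_cons]
    refine ⟨?_, ih hp.2 h'.2⟩
    intro he
    obtain ⟨a, ha, hae⟩ := List.mem_map.1 he
    rcases X.toEdge_eq_iff.1 hae with rfl | rfl
    · exact (List.nodup_cons.1 h'.2).1 (List.mem_map_of_mem ha)
    · refine h'.1 (List.mem_cons_of_mem _ (List.mem_map.2 ⟨_, ha, ?_⟩))
      rw [ter_rev]; exact hp.1

theorem IsPath.exists_init_eq {v w : V} {p : List D} (hp : X.IsPath v p w) {x : V}
    (hx : x = v ∨ x ∈ p.map X.ter) : x = w ∨ ∃ e ∈ p, X.init e = x := by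
  induction p generalizing v with
  | nil => cases hp; simpa using hx
  | cons e p ih =>
    rcases hx with rfl | hx
    · exact Or.inr ⟨e, by simp, hp.1⟩
    · rcases ih hp.2 (List.mem_cons.1 hx) with h | ⟨a, ha, h⟩
      · exact Or.inl h
      · exact Or.inr ⟨a, by simp [ha], h⟩

theorem IsPath.exists_ter_eq {v w : V} {p : List D} (hp : X.IsPath v p w) {x : V}
    (hx : x = w ∨ x ∈ p.map X.init) : x = v ∨ ∃ e ∈ p, X.ter e = x := by
  induction p generalizing v with
  | nil => cases hp; simpa using hx
  | cons e p ih =>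
    have key : x = w ∨ x ∈ p.map X.init → x = v ∨ ∃ a ∈ e :: p, X.ter a = x := by
      intro hx
      rcases ih hp.2 hx with h | ⟨a, ha, h⟩
      · exact Or.inr ⟨e, by simp, h.symm⟩
      · exact Or.inr ⟨a, by simp [ha], h⟩
    rcases hx with hx | hx
    · exact key (Or.inl hx)
    · rcases List.mem_cons.1 hx with rfl | hx
      · exact Or.inl hp.1
      · exact key (Or.inr hx)

theorem IsClosedPath.exists_init_eq_ter {p : List D} (hp : X.IsClosedPath p) {e : D} (he : e ∈ p) :
    ∃ a ∈ p, X.init a = X.ter e := by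
  obtain ⟨h0, v, hv⟩ := hp
  rcases hv.exists_init_eq (Or.inr (List.mem_map_of_mem he)) with h | h
  · obtain ⟨a, p, rfl⟩ := List.exists_cons_of_ne_nil h0
    exact ⟨a, by simp, by rw [h]; exact hv.1⟩
  · exact h

theorem IsClosedPath.exists_ter_eq_init {p : List D} (hp : X.IsClosedPath p) {e : D} (he : e ∈ p) :
    ∃ a ∈ p, X.ter a = X.init e := by
  obtain ⟨h0, v, hv⟩ := hp
  rcases hv.exists_ter_eq (Or.inr (List.mem_map_of_mem he)) with h | h
  · obtain ⟨a, p, rfl⟩ := List.exists_cons_of_ne_nil h0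
    rcases hv.2.exists_ter_eq (Or.inl rfl) with h' | ⟨b, hb, h'⟩
    · exact ⟨a, by simp, by rw [h, h']⟩
    · exact ⟨b, by simp [hb], by rw [h, h']⟩
  · exact h

end Paths

section RootedTrees

variable {V D : Type*} (X : Multigraph V D)

/-- A spanning tree oriented towards the root `r`, recorded by the function which sends a vertex
other than `r` to the first oriented edge on the way to `r`.  The absence of cycles is expressed
by a height function which decreases along the edges. -/
def IsRootedTree (r : V) (f : V → Option D) : Prop :=
  (∀ v, f v = none ↔ v = r) ∧ (∀ v e, f v = some e → X.init e = v) ∧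
    ∃ h : V → ℕ, ∀ v e, f v = some e → h (X.ter e) < h v

/-- The set of unoriented edges of a rooted tree. -/
def rootedEdges (f : V → Option D) : Set X.Edge := {x | ∃ v e, f v = some e ∧ X.toEdge e = x}

variable {X}

theorem exists_path_of_exists_path_root {r : V} {T : Set X.Edge}
    (h : ∀ v, ∃ p, X.IsPath v p r ∧ ∀ e ∈ p, X.toEdge e ∈ T) (v w : V) :
    ∃ p, X.IsPath v p w ∧ ∀ e ∈ p, X.toEdge e ∈ T := by
  obtain ⟨p, hp, hpT⟩ := h v
  obtain ⟨q, hq, hqT⟩ := h w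
  refine ⟨_, hp.append hq.reverse, fun e he => ?_⟩
  rcases List.mem_append.1 he with he | he
  · exact hpT e he
  · rw [List.mem_reverse, List.mem_map] at he
    obtain ⟨a, ha, rfl⟩ := he
    rw [toEdge_rev]
    exact hqT a ha

/-- The edges of a rooted tree form a spanning tree: following `f` leads to the root, and a cycle
would have no vertex of maximal height. -/
theorem IsRootedTree.isSpanningTree {r : V} {f : V → Option D} (hf : X.IsRootedTree r f) :
    X.IsSpanningTree (X.rootedEdges f) := by
  obtain ⟨hr, hinit, h, hh⟩ := hf
  refine ⟨exists_path_of_exists_path_root (r := r) ?_, ?_⟩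
  · intro v
    induction hn : h v using Nat.strong_induction_on generalizing v with
    | _ n ih =>
      cases hfv : f v with
      | none => exact ⟨[], (hr v).1 hfv, by simp⟩
      | some e =>
        obtain ⟨p, hp, hpT⟩ := ih _ (hn ▸ hh v e hfv) (X.ter e) rfl
        refine ⟨e :: p, ⟨hinit v e hfv, hp⟩, fun a ha => ?_⟩
        rcases List.mem_cons.1 ha with rfl | ha
        · exact ⟨v, a, hfv, rfl⟩
        · exact hpT a ha
  · rintro ⟨p, ⟨hp, hpe, -⟩, hpT⟩
    -- The two edges of the cycle at a vertex of maximal height coincide.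
    obtain ⟨e, he, hmax⟩ : ∃ e ∈ p, ∀ a ∈ p, h (X.ter a) ≤ h (X.ter e) := by
      classical
      obtain ⟨e, he, hmax⟩ := p.toFinset.exists_max_image (fun e => h (X.ter e))
        (by simpa [List.toFinset_nonempty_iff] using hp.1)
      exact ⟨e, by simpa using he, fun a ha => hmax a (by simpa using ha)⟩
    obtain ⟨u, e₁, hu, he₁⟩ := hpT e he
    obtain ⟨b, hb, hbe⟩ := hp.exists_init_eq_ter he
    obtain ⟨c, hc, hce⟩ := hp.exists_ter_eq_init he
    obtain ⟨w, b₁, hw, hb₁⟩ := hpT b hb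
    rcases X.toEdge_eq_iff.1 he₁ with rfl | rfl
    · have h1 := hh u _ hu
      have h2 := hmax c hc
      rw [hce, hinit u _ hu] at h2
      omega
    · rcases X.toEdge_eq_iff.1 hb₁ with rfl | rfl
      · have h1 := hinit _ _ hu
        have h2 := hinit _ _ hw
        rw [init_rev] at h1
        have : w = u := by rw [← h2, hbe, h1]
        subst this
        have h3 : X.rev e = b₁ := Option.some.inj (hu.symm.trans hw)
        have h4 := List.inj_on_of_nodup_map hpe he hb (by rw [← h3, toEdge_rev])
        exact X.rev_ne e (h3.trans h4.symm)
      · have h1 := hinit _ _ hw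
        have h2 := hh w _ hw
        have h3 := hmax b hb
        rw [init_rev] at h1
        rw [ter_rev, hbe, ← h1] at h2
        omega

/-- A rooted tree is determined by its set of edges, by induction on the height. -/
theorem IsRootedTree.ext {r : V} {f g : V → Option D} (hf : X.IsRootedTree r f)
    (hg : X.IsRootedTree r g) (hfg : X.rootedEdges f = X.rootedEdges g) : f = g := by
  obtain ⟨hr, hinit, h, hh⟩ := hf
  funext v
  induction hn : h v using Nat.strong_induction_on generalizing v with
  | _ n ih =>
    cases hfv : f v with
    | none => exact ((hg.1 v).2 ((hr v).1 hfv)).symm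
    | some e =>
      obtain ⟨u, a, hu, hae⟩ : X.toEdge e ∈ X.rootedEdges g := hfg ▸ ⟨v, e, hfv, rfl⟩
      have hua := hg.2.1 u a hu
      rcases X.toEdge_eq_iff.1 hae with rfl | rfl
      · rw [← hu, ← hua, hinit v a hfv]
      · rw [init_rev] at hua
        subst hua
        have h1 := hh v e hfv
        have h2 := hh _ _ ((ih _ (hn ▸ h1) _ rfl).trans hu)
        rw [ter_rev, hinit v e hfv] at h2
        omega

/-- The first edges of shortest paths to the root form a rooted tree. -/
theorem exists_isRootedTree {T : Set X.Edge} (r : V)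
    (hT : ∀ v w, ∃ p, X.IsPath v p w ∧ ∀ e ∈ p, X.toEdge e ∈ T) :
    ∃ f, X.IsRootedTree r f ∧ X.rootedEdges f ⊆ T := by
  classical
  have hex : ∀ v, ∃ n, ∃ p, X.IsPath v p r ∧ (∀ e ∈ p, X.toEdge e ∈ T) ∧ p.length = n := fun v =>
    let ⟨p, hp, hpT⟩ := hT v r
    ⟨_, p, hp, hpT, rfl⟩
  let h : V → ℕ := fun v => Nat.find (hex v)
  have step : ∀ v, v ≠ r → ∃ e, X.init e = v ∧ X.toEdge e ∈ T ∧ h (X.ter e) < h v := by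
    intro v hv
    obtain ⟨p, hp, hpT, hlen⟩ := Nat.find_spec (hex v)
    cases p with
    | nil => exact absurd hp hv
    | cons e p =>
      refine ⟨e, hp.1, hpT e (by simp), ?_⟩
      have h1 : h (X.ter e) ≤ p.length :=
        Nat.find_min' _ ⟨p, hp.2, fun a ha => hpT a (by simp [ha]), rfl⟩
      have h2 : h v = p.length + 1 := hlen.symm
      omega
  choose g hg using step
  refine ⟨fun v => if hv : v = r then none else some (g v hv), ⟨fun v => ?_, fun v e he => ?_, h,
    fun v e he => ?_⟩, ?_⟩
  · by_cases hv : v = r <;> simp [hv]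
  · by_cases hv : v = r
    · simp [hv] at he
    · obtain rfl : g v hv = e := by simpa [hv] using he
      exact (hg v hv).1
  · by_cases hv : v = r
    · simp [hv] at he
    · obtain rfl : g v hv = e := by simpa [hv] using he
      exact (hg v hv).2.2
  · rintro x ⟨v, e, he, rfl⟩
    by_cases hv : v = r
    · simp [hv] at he
    · obtain rfl : g v hv = e := by simpa [hv] using he
      exact (hg v hv).2.1

/-- A spanning tree has no connected spanning subgraph but itself. -/
theorem IsSpanningTree.eq_of_subset {S T : Set X.Edge} (hT : X.IsSpanningTree T)
    (hS : X.IsSpanningTree S) (hST : S ⊆ T) : S = T := by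
  classical
  refine hST.antisymm fun x hx => by_contra fun hxS => hT.2 ?_
  obtain ⟨e, rfl⟩ := Quotient.exists_rep x
  -- Close up a shortest path in `S` between the end points of `e`.
  have hex : ∃ n, ∃ p, X.IsPath (X.ter e) p (X.init e) ∧ (∀ a ∈ p, X.toEdge a ∈ S) ∧
      p.length = n :=
    let ⟨p, hp, hpT⟩ := hS.1 (X.ter e) (X.init e)
    ⟨_, p, hp, hpT, rfl⟩
  obtain ⟨p, hp, hpS, hlen⟩ := Nat.find_spec hex
  have hnd := hp.nodup_of_minimal hpS fun q hq hqS => by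
    rw [hlen]; exact Nat.find_min' hex ⟨q, hq, hqS, rfl⟩
  refine ⟨e :: p, ⟨⟨by simp, X.init e, rfl, hp⟩, ?_, hnd⟩, fun a ha => ?_⟩
  · rw [List.map_cons, List.nodup_cons]
    refine ⟨fun h => ?_, hp.nodup_toEdge hnd⟩
    obtain ⟨a, ha, hae⟩ := List.mem_map.1 h
    exact hxS (by have := hpS a ha; rwa [hae] at this)
  · rcases List.mem_cons.1 ha with rfl | ha
    · exact hx
    · exact hST (hpS a ha)

variable (X)

/-- For a fixed root, a spanning tree has exactly one orientation towards the root. -/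
theorem card_isRootedTree (r : V) : Nat.card {f // X.IsRootedTree r f} = X.numSpanningTrees := by
  refine Nat.card_congr (Equiv.ofBijective
    (fun f => ⟨X.rootedEdges f.1, f.2.isSpanningTree⟩) ⟨fun f g hfg => ?_, fun T => ?_⟩)
  · exact Subtype.ext (f.2.ext g.2 (congrArg Subtype.val hfg))
  · obtain ⟨f, hf, hfT⟩ := exists_isRootedTree r T.2.1
    exact ⟨⟨f, hf⟩, Subtype.ext (T.2.eq_of_subset hf.isSpanningTree hfT)⟩

theorem numSpanningTrees_pos [Finite V] [Finite D] (hX : X.Connected) : 0 < X.numSpanningTrees := by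
  obtain ⟨⟨r⟩, hc⟩ := hX
  obtain ⟨f, hf, -⟩ := exists_isRootedTree (X := X) (T := Set.univ) r fun v w =>
    let ⟨p, hp⟩ := hc v w
    ⟨p, hp, fun _ _ => trivial⟩
  rw [← X.card_isRootedTree r]
  have : Nonempty {f // X.IsRootedTree r f} := ⟨⟨f, hf⟩⟩
  exact Nat.card_pos

end RootedTrees

end Multigraph

/-! ### The matrix-tree theorem -/

namespace Multigraph

section MatrixTree

/-- The Laplacian of `X` twisted by weights `c` on the oriented edges: the valency matrix minus the
weighted adjacency matrix.  The usual Laplacian is the case `c = 1`. -/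
def twistedLaplacian {V D : Type*} [DecidableEq V] [Fintype D] {R : Type*} [CommRing R]
    (X : Multigraph V D) (c : D → R) : Matrix V V R :=
  of fun v w => ∑ e with X.init e = v, ((if v = w then 1 else 0) - if X.ter e = w then c e else 0)

theorem map_twistedLaplacian {V D : Type*} [DecidableEq V] [Fintype D] (X : Multigraph V D)
    {R S : Type*} [CommRing R] [CommRing S] (φ : R →+* S) (c : D → R) :
    (X.twistedLaplacian c).map φ = X.twistedLaplacian fun e => φ (c e) := by
  ext v w
  simp only [twistedLaplacian, map_apply, of_apply, map_sum, map_sub]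
  refine Finset.sum_congr rfl fun e _ => ?_
  split_ifs <;> simp

variable {V D : Type*} [Fintype V] [DecidableEq V] (X : Multigraph V D)

/-- The rows of the matrix of a choice function `f`: the root, where `f` takes the value `none`,
contributes a basis vector, and a vertex `v` with `f v = some e` the difference of the basis
vectors of the end points of `e`. -/
def choiceRow (r v : V) (o : Option D) : V → ℤ :=
  o.elim (Pi.single r 1) fun e => Pi.single v 1 - Pi.single (X.ter e) 1

/-- For a rooted tree the matrix is unitriangular with respect to the height. -/
theorem det_choiceRow_of_isRootedTree {r : V} {f : V → Option D} (hf : X.IsRootedTree r f) :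
    (of fun v => X.choiceRow r v (f v)).det = 1 := by
  obtain ⟨hr, -, h, hh⟩ := hf
  set N : Matrix V V ℤ := of fun v => X.choiceRow r v (f v) with hN
  have key : ∀ v w, h v ≤ h w → N v w = if v = w then 1 else 0 := by
    intro v w hvw
    rw [hN, of_apply, choiceRow]
    cases hv : f v with
    | none => simp [(hr v).1 hv, Pi.single_apply, eq_comm]
    | some e =>
      have h1 : w ≠ X.ter e := fun h2 => by
        have := hh v e hv
        rw [h2] at hvw
        omega
      simp [Pi.single_apply, h1, eq_comm]
  have hbt : N.BlockTriangular fun v => OrderDual.toDual (h v) := by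
    intro v w hvw
    have hvw' : h v < h w := hvw
    rw [key v w hvw'.le, if_neg (by rintro rfl; exact lt_irrefl _ hvw')]
  rw [hbt.det]
  refine Finset.prod_eq_one fun a _ => ?_
  have : N.toSquareBlock (fun v => OrderDual.toDual (h v)) a = 1 := by
    ext ⟨v, hv⟩ ⟨w, hw⟩
    have hvw : OrderDual.toDual (h v) = OrderDual.toDual (h w) := hv.trans hw.symm
    rw [toSquareBlock_def, of_apply, key v w (OrderDual.toDual.injective hvw).le, one_apply]
    simp
  rw [this, det_one]

/-- If `f` does not lead every vertex to the root, the matrix is singular. -/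
theorem det_choiceRow_of_not_isRootedTree {r : V} {f : V → Option D}
    (hr : ∀ v, f v = none ↔ v = r) (hinit : ∀ v e, f v = some e → X.init e = v)
    (hf : ¬ X.IsRootedTree r f) : (of fun v => X.choiceRow r v (f v)).det = 0 := by
  classical
  let par : V → V := fun v => (f v).elim v X.ter
  have hpar : ∀ v e, f v = some e → par v = X.ter e := fun v e h => by simp [par, h]
  by_cases hall : ∀ v, ∃ n, par^[n] v = r
  · refine absurd ⟨hr, hinit, fun v => Nat.find (hall v), fun v e he => ?_⟩ hf
    have hv : v ≠ r := fun h => by simp [(hr v).2 h] at he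
    have hspec := Nat.find_spec (hall v)
    obtain ⟨n, hn⟩ : ∃ n, Nat.find (hall v) = n + 1 := by
      refine Nat.exists_eq_succ_of_ne_zero fun h0 => hv ?_
      rwa [h0] at hspec
    rw [hn, Function.iterate_succ_apply, hpar v e he] at hspec
    change Nat.find (hall _) < Nat.find (hall _)
    rw [hn]
    exact Nat.lt_succ_of_le (Nat.find_min' _ hspec)
  · push Not at hall
    obtain ⟨v₀, hv₀⟩ := hall
    -- The indicator function of the vertices which never reach the root is in the kernel.
    let U : V → ℤ := fun v => if ∀ n, par^[n] v ≠ r then 1 else 0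
    refine exists_mulVec_eq_zero_iff.1 ⟨U, fun h => ?_, ?_⟩
    · have := congrFun h v₀
      simp [U, hv₀] at this
    · funext v
      have hUr : U r = 0 := if_neg fun h => h 0 rfl
      change X.choiceRow r v (f v) ⬝ᵥ U = 0
      rw [choiceRow]
      cases hv : f v with
      | none => simp [hUr]
      | some e =>
        have hvr : v ≠ r := fun h => by simp [(hr v).2 h] at hv
        have hUv : U v = U (X.ter e) := by
          have : (∀ n, par^[n] v ≠ r) ↔ ∀ n, par^[n] (X.ter e) ≠ r := by
            constructor
            · intro h n
              rw [← hpar v e hv, ← Function.iterate_succ_apply]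
              exact h _
            · rintro h (_ | n)
              · exact hvr
              · rw [Function.iterate_succ_apply, hpar v e hv]
                exact h n
          simp only [U, this]
        simp [sub_dotProduct, hUv]

variable [Fintype D]

/-- The matrix-tree theorem.  A determinant is linear in its rows, and each row of the Laplacian is
a sum over the oriented edges which leave a vertex, so that the reduced determinant is a sum over
the choices of an edge at every vertex but the root. -/
theorem adjugate_twistedLaplacian_one (r : V) :
    (X.twistedLaplacian (1 : D → ℤ)).adjugate r r = X.numSpanningTrees := by
  classical
  let A : V → Finset (Option D) := fun v =>
    if v = r then {none} else (Finset.univ.filter fun e => X.init e = v).map .some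
  have hrow : (X.twistedLaplacian (1 : D → ℤ)).updateRow r (Pi.single r 1) =
      fun v => ∑ o ∈ A v, X.choiceRow r v o := by
    funext v
    by_cases hv : v = r
    · subst hv
      rw [updateRow_self]
      simp [A, choiceRow]
    · rw [updateRow_ne hv]
      funext w
      simp only [A, if_neg hv, Finset.sum_map, Finset.sum_apply, choiceRow,
        twistedLaplacian, of_apply]
      refine Finset.sum_congr rfl fun e _ => ?_
      simp [Pi.single_apply, eq_comm]
  have hA : ∀ f, f ∈ Fintype.piFinset A ↔
      (∀ v, f v = none ↔ v = r) ∧ ∀ v e, f v = some e → X.init e = v := by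
    intro f
    rw [Fintype.mem_piFinset]
    constructor
    · intro h
      refine ⟨fun v => ⟨fun hv => by_contra fun hvr => ?_, fun hv => ?_⟩, fun v e hv => ?_⟩
      · have := h v
        simp [A, hvr, hv] at this
      · have := h v
        simpa [A, hv] using this
      · have := h v
        by_cases hvr : v = r
        · simp [A, hvr] at this
          simp [hvr, this] at hv
        · simpa [A, hvr, hv] using this
    · rintro ⟨h1, h2⟩ v
      by_cases hvr : v = r
      · subst hvr
        simp [A, (h1 v).2 rfl]
      · obtain ⟨e, he⟩ := Option.ne_none_iff_exists'.1 (mt (h1 v).1 hvr)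
        simp [A, hvr, he, h2 v e he]
  rw [adjugate_apply, hrow]
  change (detRowAlternating : (V → ℤ) [⋀^V]→ₗ[ℤ] ℤ).toMultilinearMap _ = _
  rw [MultilinearMap.map_sum_finset, ← X.card_isRootedTree r,
    Nat.card_eq_fintype_card, Fintype.card_subtype, Finset.card_filter, Nat.cast_sum,
    ← Finset.sum_subset (Finset.subset_univ (Fintype.piFinset A))]
  · refine Finset.sum_congr rfl fun f hf => ?_
    obtain ⟨h1, h2⟩ := (hA f).1 hf
    by_cases hft : X.IsRootedTree r f
    · rw [if_pos hft, Nat.cast_one]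
      exact X.det_choiceRow_of_isRootedTree hft
    · rw [if_neg hft, Nat.cast_zero]
      exact X.det_choiceRow_of_not_isRootedTree h1 h2 hft
  · intro f _ hf
    rw [if_neg fun h => hf ((hA f).2 ⟨h.1, h.2.1⟩), Nat.cast_zero]

open Polynomial in
/-- The linear coefficient of the characteristic polynomial of the Laplacian. -/
theorem coeff_one_det_X_add_twistedLaplacian_one :
    (scalar V (Polynomial.X : ℂ[X]) + (X.twistedLaplacian (1 : D → ℂ)).map C).det.coeff 1 =
      Nat.card V * X.numSpanningTrees := by
  have h : X.twistedLaplacian (1 : D → ℂ) =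
      (X.twistedLaplacian (1 : D → ℤ)).map (Int.castRingHom ℂ) := by
    rw [map_twistedLaplacian]; congr 1; funext e; simp
  rw [coeff_one_det_X_add, h, ← RingHom.mapMatrix_apply, ← RingHom.map_adjugate, trace]
  simp [adjugate_twistedLaplacian_one]

variable {R : Type*} [CommRing R]

theorem twistedLaplacian_one_mulVec_one :
    X.twistedLaplacian (1 : D → R) *ᵥ 1 = 0 := by
  funext v
  simp only [mulVec, dotProduct, twistedLaplacian, of_apply, Pi.one_apply, mul_one, Pi.zero_apply]
  rw [Finset.sum_comm]
  exact Finset.sum_eq_zero fun e _ => by simp [Finset.sum_sub_distrib]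

theorem det_twistedLaplacian_one [Nonempty V] : (X.twistedLaplacian (1 : D → R)).det = 0 := by
  have h : (X.twistedLaplacian (1 : D → ℤ)).det = 0 :=
    exists_mulVec_eq_zero_iff.1 ⟨1, one_ne_zero, X.twistedLaplacian_one_mulVec_one⟩
  have h2 : X.twistedLaplacian (1 : D → R) =
      (X.twistedLaplacian (1 : D → ℤ)).map (Int.castRingHom R) := by
    rw [map_twistedLaplacian]; congr 1; funext e; simp
  rw [h2, ← RingHom.mapMatrix_apply, ← RingHom.map_det, h, map_zero]

end MatrixTree

end Multigraph

/-! ### Bass's determinant formula -/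

namespace Multigraph

section Bass

variable {V D : Type*} (X : Multigraph V D)

theorem card_eq_two_mul_card_edge [Finite D] : Nat.card D = 2 * Nat.card X.Edge := by
  classical
  have := Fintype.ofFinite D
  have : Finite X.Edge := Quotient.finite _
  have := Fintype.ofFinite X.Edge
  rw [Nat.card_eq_fintype_card, Nat.card_eq_fintype_card, ← Finset.card_univ,
    Finset.card_eq_sum_card_fiberwise (f := X.toEdge) (t := Finset.univ) (by simp),
    Finset.sum_const_nat (m := 2), Finset.card_univ, mul_comm]
  intro x _
  obtain ⟨e, rfl⟩ := Quotient.exists_rep x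
  rw [Finset.card_eq_two]
  refine ⟨e, X.rev e, (X.rev_ne e).symm, ?_⟩
  ext a
  rw [Finset.mem_filter, Finset.mem_insert, Finset.mem_singleton]
  exact ⟨fun h => X.toEdge_eq_iff.1 h.2, fun h => ⟨Finset.mem_univ _, X.toEdge_eq_iff.2 h⟩⟩

/-- A choice of one orientation for each edge, as a function with values `1` and `-1`. -/
theorem exists_orientation (R : Type*) [CommRing R] :
    ∃ ε : D → R, (∀ e, ε e * ε e = 1) ∧ ∀ e, ε (X.rev e) = -ε e := by
  classical
  refine ⟨fun e => if e = Quotient.out (X.toEdge e) then 1 else -1, fun e => ?_, fun e => ?_⟩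
  · dsimp only
    split_ifs <;> simp
  · simp only [toEdge_rev]
    have h : X.toEdge (Quotient.out (X.toEdge e)) = X.toEdge e := Quotient.out_eq (X.toEdge e)
    rcases X.toEdge_eq_iff.1 h with h | h
    · rw [h, if_pos rfl, if_neg (X.rev_ne e)]
    · rw [h, if_pos rfl, if_neg (X.rev_ne e).symm, neg_neg]

variable {R : Type*} [CommRing R]

section

variable [DecidableEq V] [Fintype V] [Fintype D]

/-- The vertex matrix `(1 - u²) + u² Q - u A` of the determinant formula; `Q` is the diagonal matrix
of the valencies and `A` the weighted adjacency matrix. -/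
def vertexMatrix (c : D → R) (u : R) : Matrix V V R :=
  scalar V (1 - u ^ 2) +
    of fun v w => ∑ e with X.init e = v,
      ((if v = w then u ^ 2 else 0) - if X.ter e = w then u * c e else 0)

theorem vertexMatrix_one (c : D → R) : X.vertexMatrix c 1 = X.twistedLaplacian c := by
  ext v w
  simp [vertexMatrix, twistedLaplacian]

end

variable [DecidableEq D]

/-- The weighted permutation matrix of the reversal of edges. -/
def revMatrix (c : D → R) : Matrix D D R := of fun e f => if f = X.rev e then c e else 0

variable [Fintype D]

theorem revMatrix_mul_self {c : D → R} (hc : ∀ e, c e * c (X.rev e) = 1) :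
    X.revMatrix c * X.revMatrix c = 1 := by
  ext e f
  simp only [mul_apply, revMatrix, of_apply, ite_mul, zero_mul]
  rw [Finset.sum_ite_eq' Finset.univ, if_pos (Finset.mem_univ _), X.rev_rev, one_apply]
  by_cases h : f = e
  · simp [h, hc]
  · simp [h, Ne.symm h]

theorem det_one_sub_smul_revMatrix_comm (c : D → R) (u : R) :
    (1 - u • X.revMatrix c).det = (1 + u • X.revMatrix c).det := by
  obtain ⟨ε, hε, hrev⟩ := X.exists_orientation R
  have h : diagonal ε * (1 - u • X.revMatrix c) * diagonal ε = 1 + u • X.revMatrix c := by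
    ext e f
    simp only [mul_diagonal, diagonal_mul, Matrix.sub_apply, Matrix.add_apply, Matrix.smul_apply,
      revMatrix, of_apply, smul_eq_mul, one_apply]
    by_cases hef : e = f
    · subst hef
      simp [(X.rev_ne e).symm, hε]
    · by_cases hf : f = X.rev e
      · subst hf
        simp only [if_neg hef, if_true, hrev]
        linear_combination u * c e * hε e
      · simp [hef, hf]
  rw [← h, det_mul, det_mul, det_diagonal, mul_right_comm, ← Finset.prod_mul_distrib]
  simp [hε]

variable [DecidableEq V]

/-- The edge matrix (non-backtracking operator) of `X` with weights `c` on the oriented edges. -/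
def edgeMatrix (c : D → R) : Matrix D D R :=
  of fun e f => if X.ter e = X.init f ∧ f ≠ X.rev e then c e else 0

variable [Fintype V]

/-- Bass's factorisation, before the determinant of the reversal factor is evaluated. -/
theorem det_edgeMatrix_mul {c : D → R} (hc : ∀ e, c e * c (X.rev e) = 1) (u : R) :
    (1 - u ^ 2) ^ Fintype.card V *
      ((1 - u • X.edgeMatrix c).det * (1 - u • X.revMatrix c).det) =
        (1 - u ^ 2) ^ Fintype.card D * (X.vertexMatrix c u).det := by
  let T : Matrix D V R := of fun e v => if X.ter e = v then c e else 0
  let S : Matrix V D R := of fun v e => if X.init e = v then 1 else 0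
  set J := X.revMatrix c with hJ
  have hW : X.edgeMatrix c = T * S - J := by
    ext e f
    rw [Matrix.sub_apply, mul_apply, Finset.sum_eq_single (X.ter e)
      (by intro v _ hv; simp [T, hv.symm]) (by simp)]
    simp only [T, S, hJ, edgeMatrix, revMatrix, of_apply, if_true]
    by_cases h : f = X.rev e
    · subst h; simp
    · simp [h, eq_comm]
  have h1 : (1 - u • X.edgeMatrix c) * (1 - u • J) =
      scalar D (1 - u ^ 2) - T * (u • (S * (1 - u • J))) := by
    have hs : scalar D (1 - u ^ 2) = (1 - u ^ 2) • (1 : Matrix D D R) := by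
      rw [smul_one_eq_diagonal]; rfl
    rw [hs, hW, Matrix.mul_smul, ← Matrix.mul_assoc T S]
    have hJJ := X.revMatrix_mul_self hc
    rw [← hJ] at hJJ
    simp only [sub_mul, mul_sub, smul_sub, one_mul, mul_one, smul_mul, Matrix.mul_smul, hJJ,
      sub_smul, one_smul, smul_smul, sq]
    abel
  have h2 : scalar V (1 - u ^ 2) - u • (S * (1 - u • J)) * T = X.vertexMatrix c u := by
    have hST : ∀ v w, (S * T) v w = ∑ e with X.init e = v, if X.ter e = w then c e else 0 := by
      intro v w
      rw [mul_apply, Finset.sum_filter]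
      exact Finset.sum_congr rfl fun e _ => by by_cases h : X.init e = v <;> simp [S, T, h]
    have hJT : ∀ e w, (J * T) e w = if X.init e = w then 1 else 0 := by
      intro e w
      rw [mul_apply, Finset.sum_eq_single (X.rev e)
        (by intro f _ hf; simp [hJ, revMatrix, hf]) (by simp)]
      simp [hJ, revMatrix, T, hc]
    have hSJT : ∀ v w, (S * (J * T)) v w = ∑ e with X.init e = v, if v = w then 1 else 0 := by
      intro v w
      rw [mul_apply, Finset.sum_filter]
      refine Finset.sum_congr rfl fun e _ => ?_
      rw [hJT]
      by_cases h : X.init e = v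
      · simp [S, h]
      · simp [S, h]
    have h3 : u • (S * (1 - u • J)) * T = u • (S * T) - u ^ 2 • (S * (J * T)) := by
      rw [Matrix.mul_sub, Matrix.mul_one, smul_mul, Matrix.sub_mul, Matrix.mul_smul, smul_mul, smul_sub, smul_smul, sq,
        Matrix.mul_assoc]
    rw [h3, vertexMatrix, sub_eq_add_neg]
    congr 1
    ext v w
    rw [Matrix.neg_apply, Matrix.sub_apply, Matrix.smul_apply, Matrix.smul_apply, hST, hSJT,
      of_apply, Finset.sum_sub_distrib, neg_sub, smul_eq_mul, smul_eq_mul, Finset.mul_sum,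
      Finset.mul_sum]
    simp
  rw [← det_mul, h1, det_scalar_sub_mul_comm, h2]

end Bass

section BassPolynomial

open Polynomial

variable {V D : Type*} [Fintype D] [DecidableEq D] {K : Type*} [Field K] [CharZero K]
  (X : Multigraph V D)

theorem one_sub_X_sq_ne_zero : (1 - Polynomial.X ^ 2 : K[X]) ≠ 0 := fun h => by
  have := congrArg (Polynomial.eval 0) h
  simp at this

theorem det_one_sub_X_smul_revMatrix {c : D → K[X]} (hc : ∀ e, c e * c (X.rev e) = 1) :
    (1 - (Polynomial.X : K[X]) • X.revMatrix c).det =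
      (1 - Polynomial.X ^ 2 : K[X]) ^ Nat.card X.Edge := by
  set P := (1 - (Polynomial.X : K[X]) • X.revMatrix c).det with hP
  have hsq : P ^ 2 = ((1 - Polynomial.X ^ 2 : K[X]) ^ Nat.card X.Edge) ^ 2 := by
    rw [sq, hP]
    nth_rewrite 2 [X.det_one_sub_smul_revMatrix_comm c]
    have h1 : (1 - (Polynomial.X : K[X]) • X.revMatrix c) * (1 + (Polynomial.X : K[X]) • X.revMatrix c) =
        (1 - Polynomial.X ^ 2 : K[X]) • (1 : Matrix D D K[X]) := by
      simp only [sub_mul, mul_add, one_mul, mul_one, smul_mul, Matrix.mul_smul,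
        X.revMatrix_mul_self hc, sub_smul, one_smul, smul_smul, sq]
      abel
    rw [← det_mul, h1, det_smul, det_one, mul_one, ← pow_mul, mul_comm (Nat.card X.Edge),
      ← X.card_eq_two_mul_card_edge, Nat.card_eq_fintype_card]
  rcases sq_eq_sq_iff_eq_or_eq_neg.1 hsq with h | h
  · exact h
  · exfalso
    have h0 : P.eval 0 = 1 := by
      rw [hP, ← coe_evalRingHom, RingHom.map_det]
      convert det_one (n := D) (R := K)
      ext i j
      by_cases hij : i = j
      · subst hij; simp
      · simp [hij]
    have h1 := congrArg (Polynomial.eval 0) h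
    rw [h0] at h1
    simp at h1
    norm_num at h1

variable [Fintype V] [DecidableEq V]

/-- Bass's determinant formula. -/
theorem det_one_sub_X_smul_edgeMatrix {c : D → K[X]} (hc : ∀ e, c e * c (X.rev e) = 1) :
    (1 - Polynomial.X ^ 2 : K[X]) ^ Nat.card V *
      (1 - (Polynomial.X : K[X]) • X.edgeMatrix c).det =
        (1 - Polynomial.X ^ 2 : K[X]) ^ Nat.card X.Edge *
          (X.vertexMatrix c Polynomial.X).det := by
  have h := X.det_edgeMatrix_mul hc (Polynomial.X : K[X])
  rw [X.det_one_sub_X_smul_revMatrix hc, ← Nat.card_eq_fintype_card, ← Nat.card_eq_fintype_card,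
    X.card_eq_two_mul_card_edge, two_mul, pow_add, ← mul_assoc, mul_comm, ← mul_assoc] at h
  refine mul_left_cancel₀ (pow_ne_zero (Nat.card X.Edge) one_sub_X_sq_ne_zero) ?_
  rw [← mul_assoc, ← mul_assoc, h]

end BassPolynomial

end Multigraph

/-! ### Prime paths and periodic sequences -/

/-- The shift of a sequence. -/
def seqShift {D : Type*} (x : ℕ → D) : ℕ → D := fun k => x (k + 1)

theorem seqShift_iterate {D : Type*} (x : ℕ → D) (n : ℕ) : seqShift^[n] x = fun k => x (k + n) := by
  induction n generalizing x with
  | zero => rfl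
  | succ n ih =>
    rw [Function.iterate_succ_apply, ih]
    funext k
    simp only [seqShift]
    congr 1

namespace List

variable {D : Type*}

/-- The periodic sequence which repeats a non-empty list. -/
def toSeq (p : List D) (hp : p ≠ []) : ℕ → D :=
  fun k => p[k % p.length]'(Nat.mod_lt _ (List.length_pos_iff.2 hp))

theorem toSeq_congr {p q : List D} (h : p = q) (hp : p ≠ []) (hq : q ≠ []) :
    p.toSeq hp = q.toSeq hq := by subst h; rfl

theorem toSeq_of_lt {p : List D} (hp : p ≠ []) {k : ℕ} (hk : k < p.length) :
    p.toSeq hp k = p[k] := by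
  simp only [toSeq, Nat.mod_eq_of_lt hk]

theorem map_toSeq_range {p : List D} (hp : p ≠ []) : (List.range p.length).map (p.toSeq hp) = p := by
  refine List.ext_getElem (by simp) fun i h1 h2 => ?_
  simp [toSeq_of_lt hp h2]

theorem toSeq_rotate {p : List D} (hp : p ≠ []) (j : ℕ) (hj : p.rotate j ≠ []) :
    (p.rotate j).toSeq hj = seqShift^[j] (p.toSeq hp) := by
  rw [seqShift_iterate]
  funext k
  simp only [toSeq, List.getElem_rotate, List.length_rotate]
  congr 1
  rw [Nat.mod_add_mod]

theorem isPeriodicPt_toSeq {p : List D} (hp : p ≠ []) :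
    Function.IsPeriodicPt seqShift p.length (p.toSeq hp) := by
  rw [Function.IsPeriodicPt, Function.IsFixedPt, seqShift_iterate]
  funext k
  simp [toSeq]

end List

theorem apply_mod_of_isPeriodicPt {D : Type*} {x : ℕ → D} {n : ℕ}
    (hx : Function.IsPeriodicPt seqShift n x) (k : ℕ) : x (k % n) = x k := by
  have h : Function.Periodic x n := fun k => by
    have := congrFun hx k
    rwa [seqShift_iterate] at this
  exact h.map_mod_nat k

theorem toSeq_map_range {D : Type*} {x : ℕ → D} {n : ℕ}
    (hx : Function.IsPeriodicPt seqShift n x) (h : (List.range n).map x ≠ []) :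
    ((List.range n).map x).toSeq h = x := by
  funext k
  simp only [List.toSeq, List.getElem_map, List.getElem_range, List.length_map, List.length_range]
  exact apply_mod_of_isPeriodicPt hx k

theorem map_range_mul {D : Type*} {x : ℕ → D} {n : ℕ}
    (hx : Function.IsPeriodicPt seqShift n x) (a : ℕ) :
    (List.range (a * n)).map x = (List.replicate a ((List.range n).map x)).flatten := by
  induction a with
  | zero => simp
  | succ a ih =>
    rw [Nat.succ_mul, List.range_add, List.map_append, ih, List.replicate_succ',
      List.flatten_append, List.map_map]
    congr 1
    simp only [List.flatten_cons, List.flatten_nil, List.append_nil]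
    refine List.map_congr_left fun k _ => ?_
    rw [Function.comp_apply, ← apply_mod_of_isPeriodicPt hx, ← apply_mod_of_isPeriodicPt hx k]
    congr 1
    rw [mul_comm, Nat.mul_add_mod]

namespace Multigraph

section PrimePaths

variable {V D : Type*} (X : Multigraph V D)

/-- The oriented edge `f` may follow `e` in a path without backtracks. -/
def Step (e f : D) : Prop := X.ter e = X.init f ∧ f ≠ X.rev e

/-- The sequence is an infinite path without backtracks. -/
def IsReducedSeq (x : ℕ → D) : Prop := ∀ k, X.Step (x k) (x (k + 1))

variable {X}

theorem IsReducedSeq.iterate {x : ℕ → D} (hx : X.IsReducedSeq x) (j : ℕ) :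
    X.IsReducedSeq (seqShift^[j] x) := by
  rw [seqShift_iterate]
  intro k
  have := hx (k + j)
  rwa [show k + j + 1 = k + 1 + j by omega] at this

theorem isPath_cons_iff {v w : V} {e : D} {p : List D} :
    X.IsPath v (e :: p) w ↔ X.init e = v ∧ (e :: p).IsChain (fun a b => X.ter a = X.init b) ∧
      X.ter ((e :: p).getLast (by simp)) = w := by
  induction p generalizing v e with
  | nil => simp [IsPath]
  | cons f p ih =>
    change X.init e = v ∧ X.IsPath (X.ter e) (f :: p) w ↔ _
    rw [ih, List.isChain_cons_cons, List.getLast_cons (List.cons_ne_nil f p), @eq_comm _ (X.init f)]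
    tauto

/-- A non-empty list of oriented edges is a closed path without backtracks and tails if and only if
its periodic continuation is a path without backtracks. -/
theorem isReducedSeq_toSeq_iff {p : List D} (hp : p ≠ []) :
    X.IsReducedSeq (p.toSeq hp) ↔ X.IsClosedPath p ∧ p.IsChain (fun e e' => e' ≠ X.rev e) ∧
      ∀ e ∈ p.head?, ∀ e' ∈ p.getLast?, e ≠ X.rev e' := by
  have h1 : X.IsReducedSeq (p.toSeq hp) ↔
      p.IsChain X.Step ∧ X.Step (p.getLast hp) (p.head hp) := by
    have hlen := List.length_pos_iff.2 hp
    rw [List.isChain_iff_getElem, List.getLast_eq_getElem, List.head_eq_getElem]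
    constructor
    · intro h
      constructor
      · intro i hi
        have := h i
        rwa [List.toSeq_of_lt hp hi, List.toSeq_of_lt hp (by omega)] at this
      · have := h (p.length - 1)
        rw [List.toSeq_of_lt hp (by omega)] at this
        simpa [List.toSeq, Nat.sub_add_cancel hlen] using this
    · rintro ⟨ha, hb⟩ k
      have hk := Nat.mod_lt k hlen
      by_cases hk' : k % p.length + 1 < p.length
      · have := ha (k % p.length) hk'
        simp only [List.toSeq]
        have h2 : (k + 1) % p.length = k % p.length + 1 := by
          rw [← Nat.mod_add_mod, Nat.mod_eq_of_lt hk']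
        simpa only [h2] using this
      · have h2 : (k + 1) % p.length = 0 := by
          rw [← Nat.mod_add_mod, show k % p.length + 1 = p.length by omega, Nat.mod_self]
        have h3 : k % p.length = p.length - 1 := by omega
        simp only [List.toSeq]
        simpa only [h2, h3] using hb
  have h2 : p.IsChain X.Step ↔ p.IsChain (fun a b => X.ter a = X.init b) ∧
      p.IsChain (fun e e' => e' ≠ X.rev e) := by
    simp only [List.isChain_iff_getElem, Step]
    exact ⟨fun h => ⟨fun i hi => (h i hi).1, fun i hi => (h i hi).2⟩,
      fun h i hi => ⟨h.1 i hi, h.2 i hi⟩⟩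
  rw [h1, h2]
  obtain ⟨e, p, rfl⟩ := List.exists_cons_of_ne_nil hp
  simp only [IsClosedPath, isPath_cons_iff, List.head?_cons, List.getLast?_eq_some_getLast hp,
    Option.mem_some_iff, forall_eq', List.head_cons, Step]
  constructor
  · rintro ⟨⟨a, b⟩, c, d⟩
    exact ⟨⟨hp, _, rfl, a, c⟩, b, d⟩
  · rintro ⟨⟨-, v, a, b, c⟩, d, f⟩
    exact ⟨⟨b, d⟩, c.trans a.symm, f⟩

/-- A prime path is a non-empty list which is a full period of a periodic path without
backtracks. -/
theorem isPrimePath_iff {p : List D} (hp : p ≠ []) :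
    X.IsPrimePath p ↔ X.IsReducedSeq (p.toSeq hp) ∧
      Function.minimalPeriod seqShift (p.toSeq hp) = p.length := by
  rw [isReducedSeq_toSeq_iff hp, IsPrimePath]
  have hper := List.isPeriodicPt_toSeq hp
  have hlen := List.length_pos_iff.2 hp
  constructor
  · rintro ⟨h1, h2, h3, h4⟩
    refine ⟨⟨h1, h2, h3⟩, by_contra fun hne => h4 ?_⟩
    set n := Function.minimalPeriod seqShift (p.toSeq hp) with hn
    obtain ⟨a, ha⟩ := hper.minimalPeriod_dvd
    rw [← hn] at ha
    have hn0 : 0 < n := hper.minimalPeriod_pos hlen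
    have hxn : Function.IsPeriodicPt seqShift n (p.toSeq hp) :=
      Function.isPeriodicPt_minimalPeriod _ _
    have hC : (List.range n).map (p.toSeq hp) ≠ [] := by simp [hn0.ne']
    refine ⟨(List.range n).map (p.toSeq hp), a, ?_, ?_, ?_⟩
    · refine ((isReducedSeq_toSeq_iff hC).1 ?_).1
      rw [toSeq_map_range hxn]
      exact (isReducedSeq_toSeq_iff hp).2 ⟨h1, h2, h3⟩
    · rcases a with _ | _ | a
      · omega
      · omega
      · omega
    · rw [← map_range_mul hxn, mul_comm, ← ha, List.map_toSeq_range]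
  · rintro ⟨⟨h1, h2, h3⟩, h4⟩
    refine ⟨h1, h2, h3, ?_⟩
    rintro ⟨C, a, hC, ha, hpa⟩
    obtain ⟨b, rfl⟩ : ∃ b, a = b + 1 := ⟨a - 1, by omega⟩
    have hrot : p.rotate C.length = p := by
      conv_rhs => rw [hpa, List.replicate_succ', List.flatten_append]
      rw [hpa, List.replicate_succ, List.flatten_cons, List.rotate_append_length_eq]
      simp
    have h5 : Function.IsPeriodicPt seqShift C.length (p.toSeq hp) := by
      rw [Function.IsPeriodicPt, Function.IsFixedPt,
        ← List.toSeq_rotate hp _ (by rw [hrot]; exact hp)]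
      exact List.toSeq_congr hrot _ _
    have hC0 := List.length_pos_iff.2 hC.1
    have h6 := h5.minimalPeriod_le hC0
    rw [h4] at h6
    have h7 : p.length = (b + 1) * C.length := by rw [hpa]; simp
    have h8 : 2 * C.length ≤ (b + 1) * C.length := Nat.mul_le_mul_right _ ha
    omega

theorem IsPrimePath.ne_nil {p : List D} (hp : X.IsPrimePath p) : p ≠ [] := hp.1.1

/-- A full period of a periodic path without backtracks. -/
theorem isPrimePath_map_range {x : ℕ → D} (hx : X.IsReducedSeq x)
    (h0 : 0 < Function.minimalPeriod seqShift x) :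
    X.IsPrimePath ((List.range (Function.minimalPeriod seqShift x)).map x) := by
  have hne : (List.range (Function.minimalPeriod seqShift x)).map x ≠ [] := by simp [h0.ne']
  have hseq := toSeq_map_range (Function.isPeriodicPt_minimalPeriod seqShift x) hne
  rw [isPrimePath_iff hne, hseq]
  exact ⟨hx, by simp⟩

theorem map_range_isRotated_iff {x : ℕ → D} (h0 : 0 < Function.minimalPeriod seqShift x)
    {p : List D} (hp : X.IsPrimePath p) :
    (List.range (Function.minimalPeriod seqShift x)).map x ~r p ↔
      ∃ j < p.length, x = seqShift^[j] (p.toSeq hp.ne_nil) := by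
  have hne : (List.range (Function.minimalPeriod seqShift x)).map x ≠ [] := by simp [h0.ne']
  have hseq := toSeq_map_range (Function.isPeriodicPt_minimalPeriod seqShift x) hne
  have hlen := List.length_pos_iff.2 hp.ne_nil
  constructor
  · intro h
    obtain ⟨j, hj⟩ := h.symm
    refine ⟨j % p.length, Nat.mod_lt _ hlen, ?_⟩
    rw [← List.rotate_mod] at hj
    rw [← hseq, ← List.toSeq_rotate hp.ne_nil _ (by rw [hj]; exact hne)]
    exact List.toSeq_congr hj.symm _ _
  · rintro ⟨j, -, rfl⟩
    refine List.IsRotated.symm ⟨j, ?_⟩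
    have hper : seqShift^[p.length] (p.toSeq hp.ne_nil) = p.toSeq hp.ne_nil :=
      List.isPeriodicPt_toSeq hp.ne_nil
    have hrot : p.rotate j ≠ [] := by
      rw [Ne, List.rotate_eq_nil_iff]; exact hp.ne_nil
    rw [Function.minimalPeriod_apply_iterate ⟨_, hlen, hper⟩,
      ((isPrimePath_iff hp.ne_nil).1 hp).2, ← List.toSeq_rotate hp.ne_nil j hrot,
      ← List.length_rotate p j, List.map_toSeq_range hrot]

end PrimePaths

end Multigraph

/-! ### Traces of powers of a matrix -/

section PowTrace

variable {D R : Type*} [Fintype D] [DecidableEq D] [CommRing R]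

/-- The entries of a power of a matrix as sums over walks. -/
theorem Matrix.pow_apply_eq_sum (W : Matrix D D R) (m : ℕ) (e f : D) :
    (W ^ m) e f = ∑ y : Fin (m + 1) → D, if y 0 = e ∧ y (Fin.last m) = f then
      ∏ i : Fin m, W (y i.castSucc) (y i.succ) else 0 := by
  induction m generalizing e with
  | zero =>
    rw [pow_zero, one_apply, ← (Equiv.funUnique (Fin 1) D).symm.sum_comp]
    by_cases h : e = f
    · subst h
      simp
    · rw [if_neg h]
      refine (Finset.sum_eq_zero fun y _ => if_neg ?_).symm
      rintro ⟨rfl, h2⟩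
      exact h h2
  | succ m ih =>
    rw [pow_succ', Matrix.mul_apply]
    conv_rhs =>
      rw [← (Fin.consEquiv fun _ => D).sum_comp, Fintype.sum_prod_type,
        Finset.sum_eq_single e (by intro a _ ha; simp [Fin.consEquiv, ha]) (by simp)]
    simp only [ih, Finset.mul_sum]
    rw [Finset.sum_comm]
    refine Finset.sum_congr rfl fun y _ => ?_
    rw [Finset.sum_eq_single (y 0) (by intro a _ ha; simp [ha.symm]) (by simp)]
    simp only [Fin.consEquiv, Equiv.coe_fn_mk, Fin.cons_zero, true_and, ← Fin.succ_last,
      Fin.cons_succ, Fin.prod_univ_succ, Fin.castSucc_zero, ← Fin.succ_castSucc, mul_ite, mul_zero]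

/-- The periodic continuation of a finite sequence. -/
def finSeq {D : Type*} {m : ℕ} (y : Fin (m + 1) → D) : ℕ → D :=
  fun k => y ⟨k % (m + 1), Nat.mod_lt _ m.succ_pos⟩

theorem isPeriodicPt_finSeq {D : Type*} {m : ℕ} (y : Fin (m + 1) → D) :
    Function.IsPeriodicPt seqShift (m + 1) (finSeq y) := by
  rw [Function.IsPeriodicPt, Function.IsFixedPt, seqShift_iterate]
  funext k
  simp [finSeq]

/-- The trace of a power of a matrix as a sum over closed walks. -/
theorem Matrix.trace_pow_eq_sum (W : Matrix D D R) (m : ℕ) :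
    (W ^ (m + 1)).trace = ∑ y : Fin (m + 1) → D,
      ∏ k ∈ Finset.range (m + 1), W (finSeq y k) (finSeq y (k + 1)) := by
  have h : ∀ y : Fin (m + 1) → D, ∏ k ∈ Finset.range (m + 1), W (finSeq y k) (finSeq y (k + 1)) =
      (∏ i : Fin m, W (y i.castSucc) (y i.succ)) * W (y (Fin.last m)) (y 0) := by
    intro y
    have hlt : ∀ i (hi : i < m + 1), finSeq y i = y ⟨i, hi⟩ := fun i hi => by
      simp only [finSeq, Nat.mod_eq_of_lt hi]
    have hlast : finSeq y (m + 1) = y 0 := by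
      simp only [finSeq, Nat.mod_self]; rfl
    rw [Finset.prod_range_succ, Finset.prod_range, hlast, hlt m (Nat.lt_succ_self m)]
    congr 1
    refine Finset.prod_congr rfl fun i _ => ?_
    rw [hlt i (by omega), hlt (i + 1) (by omega)]
    rfl
  simp only [h, trace, diag_apply, pow_succ, mul_apply, pow_apply_eq_sum W m, Finset.sum_mul]
  calc _ = ∑ e, ∑ y : Fin (m + 1) → D, ∑ f, (if y 0 = e ∧ y (Fin.last m) = f then
        ∏ i : Fin m, W (y i.castSucc) (y i.succ) else 0) * W f e :=
        Finset.sum_congr rfl fun e _ => Finset.sum_comm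
    _ = ∑ y : Fin (m + 1) → D, ∑ e, ∑ f, (if y 0 = e ∧ y (Fin.last m) = f then
        ∏ i : Fin m, W (y i.castSucc) (y i.succ) else 0) * W f e := Finset.sum_comm
    _ = _ := Finset.sum_congr rfl fun y _ => by
      rw [Finset.sum_eq_single (y 0) (fun b _ hb => ?_) (by simp),
        Finset.sum_eq_single (y (Fin.last m)) (fun b _ hb => ?_) (by simp)]
      · simp
      · rw [if_neg fun h => hb h.2.symm, zero_mul]
      · exact Finset.sum_eq_zero fun c _ => by rw [if_neg fun h => hb h.1.symm, zero_mul]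

end PowTrace

/-! ### Counting primes by traces -/

theorem prod_range_add_of_periodic {M : Type*} [CommGroup M] {f : ℕ → M} {n : ℕ}
    (hf : ∀ k, f (k + n) = f k) (j : ℕ) :
    ∏ k ∈ Finset.range n, f (k + j) = ∏ k ∈ Finset.range n, f k := by
  induction j with
  | zero => rfl
  | succ j ih =>
    rw [← ih]
    have h := (Finset.prod_range_succ (fun k => f (k + j)) n).symm.trans
      (Finset.prod_range_succ' (fun k => f (k + j)) n)
    rw [Nat.zero_add, add_comm n j, hf] at h
    have h2 := mul_right_cancel h
    rw [h2]
    exact Finset.prod_congr rfl fun k _ => by rw [add_right_comm, add_assoc]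

theorem prod_range_mul_of_periodic {M : Type*} [CommGroup M] {f : ℕ → M} {n : ℕ}
    (hf : ∀ k, f (k + n) = f k) (a : ℕ) :
    ∏ k ∈ Finset.range (n * a), f k = (∏ k ∈ Finset.range n, f k) ^ a := by
  induction a with
  | zero => simp
  | succ a ih =>
    rw [Nat.mul_succ, Finset.prod_range_add, ih, pow_succ]
    congr 1
    rw [← prod_range_add_of_periodic hf (n * a)]
    exact Finset.prod_congr rfl fun k _ => by rw [add_comm]

namespace Multigraph

section Primes

variable {V D : Type*} {X : Multigraph V D}

/-- The product of weights of the oriented edges along a prime. -/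
def PrimeClass.weight {M : Type*} [CommMonoid M] (c : D → M) (P : X.PrimeClass) : M :=
  Quotient.lift (s := X.primeSetoid) (fun p : X.PrimePath => (p.1.map c).prod)
    (fun p q h => ((show p.1 ~r q.1 from h).perm.map c).prod_eq) P

theorem PrimeClass.length_pos (P : X.PrimeClass) : 0 < P.length := by
  obtain ⟨p, rfl⟩ := Quotient.exists_rep P
  exact List.length_pos_iff.2 p.2.ne_nil

variable (X) in
theorem finite_primeClass_length_le [Finite D] (n : ℕ) : {P : X.PrimeClass | P.length ≤ n}.Finite := by
  have h : {p : X.PrimePath | p.1.length ≤ n}.Finite :=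
    (List.finite_length_le D n).preimage Subtype.val_injective.injOn
  refine (h.image (Quotient.mk X.primeSetoid)).subset fun P hP => ?_
  obtain ⟨p, rfl⟩ := Quotient.exists_rep P
  exact ⟨p, hP, rfl⟩

/-- The prime traced out by a periodic path without backtracks. -/
noncomputable def primeOfSeq {x : ℕ → D} (hx : X.IsReducedSeq x) (h0 : 0 < Function.minimalPeriod seqShift x) :
    X.PrimeClass :=
  Quotient.mk X.primeSetoid ⟨_, isPrimePath_map_range hx h0⟩

theorem length_primeOfSeq {x : ℕ → D} (hx : X.IsReducedSeq x)
    (h0 : 0 < Function.minimalPeriod seqShift x) :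
    (primeOfSeq hx h0).length = Function.minimalPeriod seqShift x := by
  simp [primeOfSeq, PrimeClass.length]

theorem primeOfSeq_eq_iff {x : ℕ → D} (hx : X.IsReducedSeq x)
    (h0 : 0 < Function.minimalPeriod seqShift x) (p : X.PrimePath) :
    primeOfSeq hx h0 = Quotient.mk X.primeSetoid p ↔
      ∃ j < p.1.length, x = seqShift^[j] (p.1.toSeq p.2.ne_nil) :=
  Quotient.eq.trans (map_range_isRotated_iff h0 p.2)

theorem minimalPeriod_finSeq_pos {m : ℕ} (y : Fin (m + 1) → D) :
    0 < Function.minimalPeriod seqShift (finSeq y) :=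
  (isPeriodicPt_finSeq y).minimalPeriod_pos m.succ_pos

theorem finSeq_injective {m : ℕ} : Function.Injective (finSeq (D := D) (m := m)) := by
  intro y z h
  funext i
  have := congrFun h i
  simpa only [finSeq, Nat.mod_eq_of_lt i.2] using this

theorem exists_finSeq_eq {m : ℕ} {x : ℕ → D} (hx : Function.IsPeriodicPt seqShift (m + 1) x) :
    ∃ y : Fin (m + 1) → D, finSeq y = x :=
  ⟨fun i => x i, funext fun k => apply_mod_of_isPeriodicPt hx k⟩

variable [DecidableEq D] [DecidableEq V]

open Classical in
theorem prod_edgeMatrix_finSeq {K : Type*} [Field K] (c : D → Kˣ) {m : ℕ} (y : Fin (m + 1) → D) :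
    ∏ k ∈ Finset.range (m + 1),
      X.edgeMatrix (fun e => (c e : K)) (finSeq y k) (finSeq y (k + 1)) =
    if X.IsReducedSeq (finSeq y) then ((∏ k ∈ Finset.range (m + 1), c (finSeq y k) : Kˣ) : K)
      else 0 := by
  have h : X.IsReducedSeq (finSeq y) ↔
      ∀ k ∈ Finset.range (m + 1), X.Step (finSeq y k) (finSeq y (k + 1)) := by
    refine ⟨fun h k _ => h k, fun h k => ?_⟩
    have hper := isPeriodicPt_finSeq y
    have := h (k % (m + 1)) (Finset.mem_range.2 (Nat.mod_lt _ m.succ_pos))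
    rwa [apply_mod_of_isPeriodicPt hper, ← apply_mod_of_isPeriodicPt hper (k % (m + 1) + 1),
      Nat.mod_add_mod, apply_mod_of_isPeriodicPt hper] at this
  rw [Units.coe_prod]
  simp only [h, ← Finset.prod_ite_zero]
  refine Finset.prod_congr rfl fun k _ => ?_
  simp only [edgeMatrix, of_apply, Step]
  congr

/-- The trace of a power of the edge matrix counts primes: a periodic path without backtracks, of
period `m`, is a shift of a prime path `p` with `ν(p) ∣ m`, and the `ν(p)` shifts are distinct. -/
theorem trace_edgeMatrix_pow [Fintype D] {K : Type*} [Field K] (c : D → Kˣ) {m : ℕ} (hm : 0 < m)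
    (S : Finset X.PrimeClass) (hS : ∀ P : X.PrimeClass, P.length ≤ m → P ∈ S) :
    (X.edgeMatrix (fun e => (c e : K)) ^ m).trace =
      ∑ P ∈ S, if P.length ∣ m then
        (P.length : K) * ((P.weight c : Kˣ) : K) ^ (m / P.length) else 0 := by
  classical
  obtain ⟨m, rfl⟩ : ∃ n, m = n + 1 := ⟨m - 1, by omega⟩
  rw [trace_pow_eq_sum]
  simp only [prod_edgeMatrix_finSeq]
  rw [← Finset.sum_filter, Finset.sum_subtype (p := fun y : Fin (m + 1) → D =>
    X.IsReducedSeq (finSeq y)) _ (by simp)]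
  let g : {y : Fin (m + 1) → D // X.IsReducedSeq (finSeq y)} → X.PrimeClass :=
    fun y => primeOfSeq y.2 (minimalPeriod_finSeq_pos y.1)
  have hgdvd : ∀ y, (g y).length ∣ m + 1 := fun y => by
    rw [length_primeOfSeq]
    exact (isPeriodicPt_finSeq y.1).minimalPeriod_dvd
  rw [← Finset.sum_fiberwise_of_maps_to (g := g) (t := S)
    fun y _ => hS _ (Nat.le_of_dvd m.succ_pos (hgdvd y))]
  refine Finset.sum_congr rfl fun P _ => ?_
  by_cases hP : P.length ∣ m + 1
  · rw [if_pos hP]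
    obtain ⟨a, ha⟩ := hP
    have hn := P.length_pos
    obtain ⟨p, rfl⟩ := Quotient.exists_rep P
    change m + 1 = p.1.length * a at ha
    change 0 < p.1.length at hn
    change _ = (p.1.length : K) * (((p.1.map c).prod : Kˣ) : K) ^ ((m + 1) / p.1.length)
    have hdiv : (m + 1) / p.1.length = a := by rw [ha, Nat.mul_div_cancel_left _ hn]
    set x := p.1.toSeq p.2.ne_nil with hx
    obtain ⟨hred, hmin⟩ := (isPrimePath_iff p.2.ne_nil).1 p.2
    have hper : Function.IsPeriodicPt seqShift (m + 1) x := by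
      rw [ha]
      exact (List.isPeriodicPt_toSeq p.2.ne_nil).mul_const a
    have hprod : ∀ j, ∏ k ∈ Finset.range (m + 1), c (seqShift^[j] x k) =
        (p.1.map c).prod ^ a := by
      intro j
      have hper1 : ∀ k, c (x (k + (m + 1))) = c (x k) := fun k => by
        have := congrFun hper k
        rw [seqShift_iterate] at this
        exact congrArg c this
      have hper2 : ∀ k, c (x (k + p.1.length)) = c (x k) := fun k => by
        have := congrFun (List.isPeriodicPt_toSeq p.2.ne_nil) k
        rw [seqShift_iterate] at this
        exact congrArg c this
      rw [seqShift_iterate, prod_range_add_of_periodic (f := fun k => c (x k)) hper1, ha,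
        prod_range_mul_of_periodic (f := fun k => c (x k)) hper2]
      congr 1
      conv_rhs => rw [← List.map_toSeq_range p.2.ne_nil, List.map_map]
      rw [Finset.prod_eq_multiset_prod, Finset.range_val]
      rfl
    have hval : ∀ y ∈ Finset.univ.filter (g · = Quotient.mk X.primeSetoid p),
        ((∏ k ∈ Finset.range (m + 1), c (finSeq y.1 k) : Kˣ) : K) =
          (((p.1.map c).prod : Kˣ) : K) ^ a := by
      intro y hy
      obtain ⟨j, -, hj⟩ := (primeOfSeq_eq_iff y.2 (minimalPeriod_finSeq_pos y.1) p).1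
        (Finset.mem_filter.1 hy).2
      rw [hj, hprod, Units.val_pow_eq_pow_val]
    rw [Finset.sum_congr rfl hval, Finset.sum_const, nsmul_eq_mul, hdiv]
    congr 2
    rw [← Finset.card_range p.1.length]
    symm
    have hy : ∀ j, ∃ y : Fin (m + 1) → D, finSeq y = seqShift^[j] x := fun j =>
      exists_finSeq_eq (hper.apply_iterate j)
    choose Y hY using hy
    refine Finset.card_bij (fun j _ => ⟨Y j, by rw [hY]; exact hred.iterate j⟩) ?_ ?_ ?_
    · intro j hj
      rw [Finset.mem_filter]
      refine ⟨Finset.mem_univ _, (primeOfSeq_eq_iff _ _ p).2 ⟨j, Finset.mem_range.1 hj, hY j⟩⟩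
    · intro i hi j hj hij
      have h1 : Y i = Y j := congrArg Subtype.val hij
      have h2 : seqShift^[i] x = seqShift^[j] x := by rw [← hY, ← hY, h1]
      refine Function.iterate_injOn_Iio_minimalPeriod ?_ ?_ h2
      · rw [hmin]; exact Finset.mem_range.1 hi
      · rw [hmin]; exact Finset.mem_range.1 hj
    · intro y hy
      obtain ⟨j, hj, hj'⟩ := (primeOfSeq_eq_iff y.2 (minimalPeriod_finSeq_pos y.1) p).1
        (Finset.mem_filter.1 hy).2
      exact ⟨j, Finset.mem_range.2 hj, Subtype.ext (finSeq_injective (by rw [hY, hj']))⟩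
  · rw [if_neg hP]
    refine Finset.sum_eq_zero fun y hy => absurd ?_ hP
    rw [← (Finset.mem_filter.1 hy).2]
    exact hgdvd y

end Primes

end Multigraph

/-! ### The Euler product -/

section EulerFactor

open PowerSeries

variable {K : Type*} [Field K]

theorem PowerSeries.eulerDerivation_inv {F S : PowerSeries K} (hF : coeff 0 F ≠ 0)
    (h : eulerDerivation K F = F * S) : eulerDerivation K F⁻¹ = F⁻¹ * -S := by
  have hFF : F * F⁻¹ = 1 := PowerSeries.mul_inv_cancel F (by rwa [← coeff_zero_eq_constantCoeff_apply])
  have h1 := congrArg (eulerDerivation K) hFF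
  rw [Derivation.leibniz, Derivation.map_one_eq_zero, h, smul_eq_mul, smul_eq_mul] at h1
  linear_combination F⁻¹ * h1 + (-(eulerDerivation K F⁻¹) - F⁻¹ * S) * hFF

theorem PowerSeries.eulerDerivation_prod {ι : Type*} (s : Finset ι) {F S : ι → PowerSeries K}
    (h : ∀ i ∈ s, eulerDerivation K (F i) = F i * S i) :
    eulerDerivation K (∏ i ∈ s, F i) = (∏ i ∈ s, F i) * ∑ i ∈ s, S i := by
  classical
  induction s using Finset.induction_on with
  | empty => simp
  | insert a s ha ih =>
    rw [Finset.prod_insert ha, Finset.sum_insert ha, Derivation.leibniz, h a (by simp),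
      ih fun i hi => h i (by simp [hi]), smul_eq_mul, smul_eq_mul]
    ring

/-- The logarithmic derivative of the Euler factor `(1 - a u ^ ν)⁻¹`. -/
noncomputable def eulerFactorLogDeriv (a : K) (ν : ℕ) : PowerSeries K :=
  PowerSeries.mk fun m => if m = 0 then 0 else if ν ∣ m then (ν : K) * a ^ (m / ν) else 0

theorem eulerDerivation_one_sub_C_mul_X_pow (a : K) {ν : ℕ} (hν : 0 < ν) :
    eulerDerivation K (1 - C a * PowerSeries.X ^ ν) =
      (1 - C a * PowerSeries.X ^ ν) * -eulerFactorLogDeriv a ν := by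
  ext m
  rw [coeff_eulerDerivation, sub_mul, one_mul, mul_neg, map_sub, map_sub, map_neg, map_neg,
    mul_assoc, coeff_C_mul, coeff_C_mul, coeff_X_pow_mul', coeff_one, coeff_X_pow]
  simp only [eulerFactorLogDeriv, coeff_mk]
  by_cases hm : m = 0
  · subst hm
    simp [hν.ne']
  rw [if_neg hm, if_neg hm]
  by_cases hle : ν ≤ m
  · rw [if_pos hle]
    by_cases heq : m = ν
    · subst heq
      simp [Nat.div_self hν]
    · have h1 : m - ν ≠ 0 := by omega
      rw [if_neg heq, if_neg h1]
      by_cases hd : ν ∣ m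
      · have hd' : ν ∣ m - ν := Nat.dvd_sub hd dvd_rfl
        obtain ⟨k, rfl⟩ := hd
        have hk : 1 ≤ k := by
          rcases Nat.eq_zero_or_pos k with rfl | hk
          · simp at hm
          · exact hk
        have h2 : (ν * k - ν) / ν = k - 1 := by
          rw [← Nat.mul_sub_one, Nat.mul_div_cancel_left _ hν]
        rw [if_pos (Dvd.intro k rfl), if_pos hd', h2, Nat.mul_div_cancel_left _ hν]
        obtain ⟨l, rfl⟩ : ∃ l, k = l + 1 := ⟨k - 1, by omega⟩
        simp only [Nat.add_sub_cancel, pow_succ]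
        ring
      · have hd' : ¬ ν ∣ m - ν := fun h => hd ((Nat.dvd_sub_iff_left hle dvd_rfl).1 h)
        rw [if_neg hd, if_neg hd']
        simp
  · have hd : ¬ ν ∣ m := fun h => hle (Nat.le_of_dvd (Nat.pos_of_ne_zero hm) h)
    have heq : m ≠ ν := by omega
    simp [hle, hd, heq]

end EulerFactor

namespace Multigraph

open scoped PowerSeries.WithPiTopology PowerSeries
open PowerSeries

variable {V D : Type*} [Fintype D] [DecidableEq D] [DecidableEq V] (X : Multigraph V D)

/-- The Euler product over the primes of `X` is the reciprocal of the characteristic polynomial of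
the edge matrix: up to any given degree both sides have the same logarithmic derivative. -/
theorem hasProd_euler (c : D → ℂˣ) :
    HasProd (fun P : X.PrimeClass =>
        (1 - C ((P.weight c : ℂˣ) : ℂ) * PowerSeries.X ^ P.length : ℂ⟦X⟧)⁻¹)
      (1 - (PowerSeries.X : ℂ⟦X⟧) • (X.edgeMatrix fun e => (c e : ℂ)).map C).det⁻¹ := by
  classical
  set W := X.edgeMatrix fun e => (c e : ℂ)
  set Δ : ℂ⟦X⟧ := (1 - (PowerSeries.X : ℂ⟦X⟧) • W.map C).det with hΔ
  have hΔ0 : coeff 0 Δ = 1 := by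
    rw [coeff_zero_eq_constantCoeff, hΔ, RingHom.map_det]
    convert det_one (n := D) (R := ℂ)
    ext i j
    by_cases hij : i = j
    · subst hij; simp
    · simp [hij]
  have hinv0 : ∀ F : ℂ⟦X⟧, coeff 0 F = 1 → coeff 0 F⁻¹ = 1 := fun F hF => by
    rw [coeff_zero_eq_constantCoeff] at hF ⊢
    simp [constantCoeff_inv, hF]
  have hfac : ∀ P : X.PrimeClass,
      coeff 0 (1 - C ((P.weight c : ℂˣ) : ℂ) * PowerSeries.X ^ P.length : ℂ⟦X⟧) = 1 := fun P => by
    rw [map_sub, coeff_C_mul, coeff_X_pow, if_neg P.length_pos.ne]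
    simp
  have hΔd := eulerDerivation_inv (by rw [hΔ0]; exact one_ne_zero)
    W.eulerDerivation_det_one_sub
  rw [HasProd, WithPiTopology.tendsto_iff_coeff_tendsto]
  intro n
  refine tendsto_const_nhds.congr' ?_
  rw [SummationFilter.unconditional_filter]
  filter_upwards [Filter.eventually_ge_atTop (X.finite_primeClass_length_le n).toFinset] with s hs
  have hs' : ∀ P : X.PrimeClass, P.length ≤ n → P ∈ s := fun P hP => hs (by simpa using hP)
  refine coeff_eq_of_eulerDerivation (hinv0 _ hΔ0) ?_ hΔd (eulerDerivation_prod s fun P _ =>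
    eulerDerivation_inv (by rw [hfac]; exact one_ne_zero)
      (eulerDerivation_one_sub_C_mul_X_pow _ P.length_pos)) n ?_
  · rw [coeff_zero_eq_constantCoeff, map_prod]
    refine Finset.prod_eq_one fun P _ => ?_
    rw [← coeff_zero_eq_constantCoeff_apply]
    exact hinv0 _ (hfac P)
  · intro i hi
    rw [neg_neg, map_sum]
    simp only [neg_neg, tracePowSeries, eulerFactorLogDeriv, coeff_mk]
    by_cases h0 : i = 0
    · simp [h0]
    · simp only [if_neg h0]
      exact X.trace_edgeMatrix_pow c (Nat.pos_of_ne_zero h0) s fun P hP => hs' P (hP.trans hi)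

end Multigraph

/-! ### Voltages of a Galois cover -/

namespace Multigraph

namespace Hom

variable {W F V D : Type*} {Y : Multigraph W F} {X : Multigraph V D} {π : Y.Hom X}

theorem map_ter (π : Y.Hom X) (f : F) : X.ter (π.onDart f) = π.onVert (Y.ter f) := by
  rw [ter, ter, ← π.map_rev, π.map_init]

theorem IsCovering.dart_ext (hπ : π.IsCovering) {f f' : F} (h : Y.init f = Y.init f')
    (h' : π.onDart f = π.onDart f') : f = f' :=
  (hπ.2 (Y.init f)).injOn rfl h.symm h'

theorem IsCovering.exists_dart (hπ : π.IsCovering) {w : W} {e : D} (h : X.init e = π.onVert w) :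
    ∃ f, Y.init f = w ∧ π.onDart f = e :=
  let ⟨f, hf, hf'⟩ := (hπ.2 w).surjOn h
  ⟨f, hf, hf'⟩

/-- Paths lift along a covering. -/
theorem IsCovering.exists_lift (hπ : π.IsCovering) {p : List D} {v x : V} (hp : X.IsPath v p x)
    {w : W} (hw : π.onVert w = v) :
    ∃ q w', q.map π.onDart = p ∧ Y.IsPath w q w' ∧ π.onVert w' = x := by
  induction p generalizing v w with
  | nil => exact ⟨[], w, rfl, rfl, hw.trans hp⟩
  | cons e p ih =>
    obtain ⟨f, hf, hfe⟩ := hπ.exists_dart (hp.1.trans hw.symm)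
    obtain ⟨q, w', hq, hq', hw'⟩ := ih hp.2 (w := Y.ter f) (by rw [← π.map_ter, hfe])
    exact ⟨f :: q, w', by rw [List.map_cons, hfe, hq], ⟨hf, hq'⟩, hw'⟩

theorem aut_init (g : π.aut) (f : F) : Y.init (g.1.2 f) = g.1.1 (Y.init f) := g.2.1 f

theorem aut_rev (g : π.aut) (f : F) : g.1.2 (Y.rev f) = Y.rev (g.1.2 f) := g.2.2.1 f

theorem aut_ter (g : π.aut) (f : F) : Y.ter (g.1.2 f) = g.1.1 (Y.ter f) := by
  rw [ter, ← aut_rev, aut_init, ter]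

theorem onVert_aut (g : π.aut) (w : W) : π.onVert (g.1.1 w) = π.onVert w := g.2.2.2.1 w

theorem onDart_aut (g : π.aut) (f : F) : π.onDart (g.1.2 f) = π.onDart f := g.2.2.2.2 f

/-- An automorphism of a connected cover which fixes a vertex is the identity. -/
theorem IsCovering.aut_eq_one (hπ : π.IsCovering) (hY : Y.Connected) {g : π.aut} {w : W}
    (hg : g.1.1 w = w) : g = 1 := by
  have hdart : ∀ f, g.1.1 (Y.init f) = Y.init f → g.1.2 f = f := fun f hf =>
    hπ.dart_ext (by rw [aut_init, hf]) (onDart_aut g f)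
  have hpath : ∀ p w w', Y.IsPath w p w' → g.1.1 w = w → g.1.1 w' = w' := by
    intro p
    induction p with
    | nil => rintro w w' rfl h; exact h
    | cons f p ih =>
      rintro w w' ⟨rfl, h2⟩ h
      exact ih _ _ h2 (by rw [← aut_ter, hdart f h])
  have hvert : ∀ w', g.1.1 w' = w' := fun w' =>
    let ⟨p, hp⟩ := hY.2 w w'
    hpath p w w' hp hg
  exact Subtype.ext (Prod.ext (Equiv.ext hvert) (Equiv.ext fun f => hdart f (hvert _)))

/-- A trivialisation of a Galois cover `π : Y → X` over the vertices: a bijection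
`V × Aut(Y/X) ≃ W`, compatible with the projections and the actions, together with voltages
`α e ∈ Aut(Y/X)` on the oriented edges of `X`, such that an oriented edge above `e` leads from
`(v, g)` to `(w, g * α e)`. -/
structure Voltage (π : Y.Hom X) where
  /-- the voltage of an oriented edge -/
  volt : D → π.aut
  /-- the trivialisation over the vertices -/
  triv : V × π.aut ≃ W
  volt_rev : ∀ e, volt (X.rev e) = (volt e)⁻¹
  onVert_triv : ∀ a, π.onVert (triv a) = a.1
  aut_triv : ∀ (h : π.aut) v g, h.1.1 (triv (v, g)) = triv (v, h * g)
  ter_eq : ∀ (f : F) (g : π.aut), Y.init f = triv (X.init (π.onDart f), g) →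
    Y.ter f = triv (X.ter (π.onDart f), g * volt (π.onDart f))

theorem IsGalois.nonempty_voltage (hπ : π.IsGalois) (hY : Y.Connected) : Nonempty π.Voltage := by
  obtain ⟨hcov, htrans⟩ := hπ
  choose s hs using hcov.1
  have hfree : ∀ (g h : π.aut) (w : W), g.1.1 w = h.1.1 w → g = h := by
    intro g h w hgh
    refine (inv_mul_eq_one.1 (hcov.aut_eq_one hY (g := h⁻¹ * g) (w := w) ?_)).symm
    change h.1.1.symm (g.1.1 w) = w
    rw [hgh, Equiv.symm_apply_apply]
  have hbij : Function.Bijective fun a : V × π.aut => a.2.1.1 (s a.1) := by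
    constructor
    · rintro ⟨v, g⟩ ⟨w, h⟩ hgh
      dsimp only at hgh
      obtain rfl : v = w := by
        have := congrArg π.onVert hgh
        rwa [onVert_aut, onVert_aut, hs, hs] at this
      rw [hfree g h _ hgh]
    · intro w
      obtain ⟨g, hg, hgw⟩ := htrans (s (π.onVert w)) w (hs _)
      exact ⟨(π.onVert w, ⟨g, hg⟩), hgw⟩
  let Φ := Equiv.ofBijective _ hbij
  have hΦ : ∀ v g, Φ (v, g) = g.1.1 (s v) := fun v g => rfl
  have hΦ1 : ∀ a, π.onVert (Φ a) = a.1 := fun a => by rw [hΦ, onVert_aut, hs]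
  have hΦ2 : ∀ (h : π.aut) v g, h.1.1 (Φ (v, g)) = Φ (v, h * g) := fun h v g => rfl
  have hlift : ∀ e, ∃ f g, Y.init f = Φ (X.init e, 1) ∧ π.onDart f = e ∧
      Y.ter f = Φ (X.ter e, g) := by
    intro e
    obtain ⟨f, hf, hfe⟩ := hcov.exists_dart (w := Φ (X.init e, 1)) (e := e) (by rw [hΦ1])
    obtain ⟨⟨v, g⟩, hvg⟩ := Φ.surjective (Y.ter f)
    refine ⟨f, g, hf, hfe, ?_⟩
    have h1 := hΦ1 (v, g)
    rw [hvg, ← π.map_ter, hfe] at h1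
    rw [← hvg]
    exact congrArg (fun v => Φ (v, g)) h1.symm
  choose l α hl1 hl2 hl3 using hlift
  have hter : ∀ (f : F) (g : π.aut), Y.init f = Φ (X.init (π.onDart f), g) →
      Y.ter f = Φ (X.ter (π.onDart f), g * α (π.onDart f)) := by
    intro f g hf
    have h1 : f = g.1.2 (l (π.onDart f)) := hcov.dart_ext
      (by rw [aut_init, hl1, hΦ2, mul_one, hf]) (by rw [onDart_aut, hl2])
    conv_lhs => rw [h1, aut_ter, hl3, hΦ2]
  refine ⟨⟨α, Φ, fun e => ?_, hΦ1, hΦ2, hter⟩⟩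
  have h1 := hter (Y.rev (l e)) (α e) (by rw [init_rev, hl3, π.map_rev, hl2, init_rev])
  rw [ter_rev, hl1, π.map_rev, hl2, ter_rev] at h1
  exact (inv_eq_of_mul_eq_one_right (Prod.ext_iff.1 (Φ.injective h1)).2.symm).symm

namespace Voltage

variable (A : π.Voltage)

theorem card_aut (A : π.Voltage) {d : ℕ} (hd : π.HasDegree d) (hX : Nonempty V) :
    Nat.card π.aut = d := by
  obtain ⟨v⟩ := hX
  rw [← hd v]
  refine Nat.card_congr (Equiv.ofBijective (fun g => ⟨A.triv (v, g), A.onVert_triv _⟩) ⟨?_, ?_⟩)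
  · intro g h hgh
    exact (Prod.ext_iff.1 (A.triv.injective (congrArg Subtype.val hgh))).2
  · rintro ⟨w, hw⟩
    obtain ⟨⟨v', g⟩, rfl⟩ := A.triv.surjective w
    rw [A.onVert_triv] at hw
    subst hw
    exact ⟨g, rfl⟩

/-- A path of `Y` moves the group coordinate by the product of the voltages along its image. -/
theorem path_eq {q : List F} {w w' : W} (hq : Y.IsPath w q w') (g : π.aut)
    (hw : w = A.triv (π.onVert w, g)) :
    w' = A.triv (π.onVert w', g * ((q.map π.onDart).map A.volt).prod) := by
  induction q generalizing w g with
  | nil => cases hq; simpa using hw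
  | cons f q ih =>
    obtain ⟨rfl, hq⟩ := hq
    have h1 := A.ter_eq f g (by rwa [π.map_init])
    rw [π.map_ter] at h1
    have h2 := ih hq _ h1
    rwa [mul_assoc] at h2

/-- The Frobenius automorphism of a prime is the product of the voltages along it. -/
theorem frobenius_eq (hπ : π.IsGalois) (hG : ∀ σ τ : π.aut, σ * τ = τ * σ) (P : X.PrimeClass) :
    ∀ p : X.PrimePath, Quotient.mk X.primeSetoid p = P →
      (p.1.map A.volt).prod = π.frobenius P := by
  let _ : CommGroup π.aut := { (inferInstance : Group π.aut) with mul_comm := hG }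
  -- The product is independent of the initial vertex, the group being abelian.
  have hrot : ∀ p q : X.PrimePath, Quotient.mk X.primeSetoid p = Quotient.mk X.primeSetoid q →
      (p.1.map A.volt).prod = (q.1.map A.volt).prod := fun p q h =>
    ((show p.1 ~r q.1 from Quotient.exact h).perm.map A.volt).prod_eq
  have hex : ∃ g, π.IsFrobenius P g := by
    obtain ⟨p, rfl⟩ := Quotient.exists_rep P
    obtain ⟨-, v, hv⟩ := p.2.1
    obtain ⟨w, hw⟩ := hπ.1.1 v
    obtain ⟨q, w', hq, hq', hw'⟩ := hπ.1.exists_lift hv hw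
    obtain ⟨g, hg, hgw⟩ := hπ.2 w w' (hw.trans hw'.symm)
    exact ⟨⟨g, hg⟩, p, rfl, q, w, w', hq, hq', hgw⟩
  obtain ⟨p, hp, q, w, w', hq, hq', hg⟩ := Classical.epsilon_spec hex
  intro p' hp'
  rw [hrot p' p (hp'.trans hp.symm)]
  change _ = Classical.epsilon (π.IsFrobenius P)
  set g := Classical.epsilon (π.IsFrobenius P)
  obtain ⟨⟨v, h⟩, rfl⟩ := A.triv.surjective w
  have h1 := A.path_eq hq' h (by rw [A.onVert_triv])
  rw [← hg, A.aut_triv, A.onVert_triv, hq] at h1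
  have h2 : g * h = h * (p.1.map A.volt).prod := (Prod.ext_iff.1 (A.triv.injective h1)).2
  rw [hG h] at h2
  exact (mul_right_cancel h2).symm

end Voltage

end Hom

end Multigraph

/-! ### The Laplacian of a cover -/

namespace Multigraph

namespace Hom

namespace Voltage

variable {W F V D : Type*} {Y : Multigraph W F} {X : Multigraph V D} {π : Y.Hom X}
  (A : π.Voltage)

/-- The weights on the oriented edges of `X` given by a character of `Aut(Y/X)`. -/
def charWeight (χ : π.aut →* ℂˣ) (e : D) : ℂ := (χ (A.volt e) : ℂ)

theorem charWeight_mul_rev (χ : π.aut →* ℂˣ) (e : D) :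
    A.charWeight χ e * A.charWeight χ (X.rev e) = 1 := by
  rw [charWeight, charWeight, ← Units.val_mul, ← map_mul, A.volt_rev, mul_inv_cancel, map_one,
    Units.val_one]

theorem charWeight_one : A.charWeight 1 = 1 := by
  funext e; simp [charWeight]

variable [DecidableEq V] [Fintype D] [Fintype F]

/-- The Laplacian of the cover in the trivialisation. -/
theorem twistedLaplacian_triv [DecidableEq W] (hπ : π.IsCovering) [DecidableEq π.aut] {R : Type*}
    [CommRing R] (a b : V × π.aut) :
    Y.twistedLaplacian (1 : F → R) (A.triv a) (A.triv b) = ∑ e with X.init e = a.1,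
      ((if a.1 = b.1 then (if a.2⁻¹ * b.2 = 1 then 1 else 0) else 0) -
        if X.ter e = b.1 then (if a.2⁻¹ * b.2 = A.volt e then 1 else 0) else 0) := by
  rw [twistedLaplacian, of_apply]
  refine Finset.sum_bij (fun f _ => π.onDart f) ?_ ?_ ?_ ?_
  · intro f hf
    rw [Finset.mem_filter] at hf ⊢
    refine ⟨Finset.mem_univ _, ?_⟩
    rw [π.map_init, hf.2, A.onVert_triv]
  · intro f hf f' hf' h
    rw [Finset.mem_filter] at hf hf'
    exact hπ.dart_ext (hf.2.trans hf'.2.symm) h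
  · intro e he
    rw [Finset.mem_filter] at he
    obtain ⟨f, hf, hfe⟩ := hπ.exists_dart (w := A.triv a) (he.2.trans (A.onVert_triv a).symm)
    exact ⟨f, by simp [hf], hfe⟩
  · intro f hf
    rw [Finset.mem_filter] at hf
    have hinit : X.init (π.onDart f) = a.1 := by rw [π.map_init, hf.2, A.onVert_triv]
    have hter := A.ter_eq f a.2 (by rw [hf.2, hinit])
    rw [hter]
    congr 1
    · rw [← ite_and]
      refine if_congr ?_ rfl rfl
      rw [A.triv.injective.eq_iff, Prod.ext_iff, inv_mul_eq_one]
    · rw [← ite_and]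
      refine if_congr ?_ rfl rfl
      rw [A.triv.injective.eq_iff, Prod.ext_iff, inv_mul_eq_iff_eq_mul, eq_comm (a := b.2)]

variable [Fintype V]

open Polynomial in
/-- The characteristic polynomial of the Laplacian of the cover is the product of those of the
twisted Laplacians of the base. -/
theorem det_X_add_twistedLaplacian [Fintype W] [DecidableEq W] (hπ : π.IsCovering)
    (hG : ∀ σ τ : π.aut, σ * τ = τ * σ) [Finite π.aut] [Fintype (π.aut →* ℂˣ)] :
    (scalar W (Polynomial.X : ℂ[X]) + (Y.twistedLaplacian (1 : F → ℂ)).map C).det =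
      ∏ χ : π.aut →* ℂˣ,
        (scalar V (Polynomial.X : ℂ[X]) + (X.twistedLaplacian (A.charWeight χ)).map C).det := by
  classical
  let _ : CommGroup π.aut := { (inferInstance : Group π.aut) with mul_comm := hG }
  have := Fintype.ofFinite π.aut
  let K : π.aut → Matrix V V ℂ[X] := fun k => of fun v w =>
    (if k = 1 then scalar V (Polynomial.X : ℂ[X]) v w else 0) + ∑ e with X.init e = v,
      ((if v = w then (if k = 1 then 1 else 0) else 0) -
        if X.ter e = w then (if k = A.volt e then 1 else 0) else 0)
  rw [← det_submatrix_equiv_self A.triv]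
  have h := det_groupMatrix K
  convert h using 2
  · ext1 a b
    rw [submatrix_apply, Matrix.add_apply, map_apply, A.twistedLaplacian_triv hπ]
    simp only [of_apply, K]
    congr 1
    · rw [scalar_apply, scalar_apply, diagonal_apply, diagonal_apply, ← ite_and]
      refine if_congr ?_ rfl rfl
      rw [A.triv.injective.eq_iff, Prod.ext_iff, and_comm, inv_mul_eq_one]
    · rw [map_sum]
      refine Finset.sum_congr rfl fun e _ => ?_
      rw [map_sub]
      congr 1 <;> split_ifs <;> simp
  · rename_i χ _
    congr 1
    ext1 v w
    rw [Matrix.sum_apply]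
    simp only [Matrix.smul_apply, of_apply, K, smul_eq_mul, mul_add, Finset.sum_add_distrib,
      Finset.mul_sum]
    rw [Matrix.add_apply]
    congr 1
    · rw [Finset.sum_eq_single 1 (by intro k _ hk; simp [hk]) (by simp)]
      simp
    · rw [Finset.sum_comm, map_apply, twistedLaplacian, of_apply, map_sum]
      refine Finset.sum_congr rfl fun e _ => ?_
      simp only [mul_sub, Finset.sum_sub_distrib, map_sub]
      congr 1
      · by_cases h : v = w <;> simp [h]
      · by_cases h : X.ter e = w <;> simp [h, charWeight]

/-- Comparison of the linear coefficients in `det_X_add_twistedLaplacian`: the factor of the trivial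
character has constant coefficient zero. -/
theorem card_mul_numSpanningTrees [Finite W] (hπ : π.IsCovering)
    (hG : ∀ σ τ : π.aut, σ * τ = τ * σ) [Finite π.aut] [Fintype (π.aut →* ℂˣ)]
    [DecidableEq (π.aut →* ℂˣ)] [Nonempty V] :
    (Nat.card W : ℂ) * Y.numSpanningTrees = Nat.card V * X.numSpanningTrees *
      ∏ χ ∈ Finset.univ.erase (1 : π.aut →* ℂˣ), (X.twistedLaplacian (A.charWeight χ)).det := by
  classical
  have := Fintype.ofFinite W
  have h0 : ∀ χ : π.aut →* ℂˣ, (scalar V (Polynomial.X : Polynomial ℂ) +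
      (X.twistedLaplacian (A.charWeight χ)).map Polynomial.C).det.coeff 0 =
        (X.twistedLaplacian (A.charWeight χ)).det := by
    intro χ
    rw [Polynomial.coeff_zero_eq_eval_zero, ← Polynomial.coe_evalRingHom, RingHom.map_det]
    congr 1
    ext i j
    by_cases hij : i = j
    · subst hij; simp
    · simp [hij]
  rw [← coeff_one_det_X_add_twistedLaplacian_one, A.det_X_add_twistedLaplacian hπ hG,
    ← Finset.mul_prod_erase _ _ (Finset.mem_univ (1 : π.aut →* ℂˣ)), Polynomial.mul_coeff_one,
    h0, A.charWeight_one, det_twistedLaplacian_one, zero_mul, zero_add,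
    coeff_one_det_X_add_twistedLaplacian_one, Polynomial.coeff_zero_prod]
  simp only [h0]

end Voltage

end Hom

end Multigraph

/-! ### An index in the group ring -/

section GroupRing

variable {G : Type*} [CommGroup G] [Finite G]

/-- The evaluation of the elements of a group ring at a complex character of the group. -/
noncomputable def charEval {G : Type*} [Group G] (R : Type*) [CommSemiring R] [Algebra R ℂ]
    (χ : G →* ℂˣ) : MonoidAlgebra R G →ₐ[R] ℂ :=
  MonoidAlgebra.lift R ℂ G ((Units.coeHom ℂ).comp χ)

theorem charEval_single {G : Type*} [Group G] {R : Type*} [CommSemiring R] [Algebra R ℂ]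
    (χ : G →* ℂˣ) (g : G) (r : R) :
    charEval R χ (MonoidAlgebra.single g r) = algebraMap R ℂ r * (χ g : ℂ) := by
  rw [charEval, MonoidAlgebra.lift_single, Algebra.smul_def]
  rfl

theorem charEval_apply {G : Type*} [Group G] [Fintype G] {R : Type*} [CommSemiring R] [Algebra R ℂ]
    (χ : G →* ℂˣ) (x : MonoidAlgebra R G) :
    charEval R χ x = ∑ g, algebraMap R ℂ (x.coeff g) * (χ g : ℂ) := by
  rw [charEval, MonoidAlgebra.lift_apply, Finsupp.sum_fintype _ _ (by simp)]
  exact Finset.sum_congr rfl fun g _ => by rw [Algebra.smul_def]; rfl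

theorem charEval_mapRingHom {G : Type*} [Group G] (χ : G →* ℂˣ) (x : MonoidAlgebra ℤ G) :
    charEval ℂ χ (MonoidAlgebra.mapRingHom G (Int.castRingHom ℂ) x) = charEval ℤ χ x :=
  MonoidAlgebra.lift_mapRingHom_algebraMap (S := ℂ) ((Units.coeHom ℂ).comp χ) x

/-- The characters separate the elements of the group algebra. -/
theorem MonoidAlgebra.eq_of_charEval_eq {x y : MonoidAlgebra ℂ G}
    (h : ∀ χ : G →* ℂˣ, charEval ℂ χ x = charEval ℂ χ y) : x = y := by
  classical
  have := Fintype.ofFinite G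
  obtain ⟨e⟩ := nonempty_equiv_characters (G := G)
  have hC := isUnit_characterTable e
  have hv : (x.coeff : G → ℂ) = y.coeff := by
    refine vecMul_injective_of_isUnit hC ?_
    funext k
    have := h (e k)
    rw [charEval_apply, charEval_apply] at this
    exact this
  exact MonoidAlgebra.coeff_injective (DFunLike.coe_injective hv)

theorem charEval_int_eq_of_one {G : Type*} [Group G] (x : MonoidAlgebra ℤ G) :
    charEval ℤ 1 x = (MonoidAlgebra.lift ℤ ℤ G 1 x : ℤ) := by
  induction x using MonoidAlgebra.induction_linear with
  | zero => simp
  | add x y hx hy => rw [map_add, map_add, hx, hy]; push_cast; rfl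
  | single g n => simp [charEval_single]

/-- The determinant of the multiplication by an element of the group ring. -/
theorem det_mulLeft_eq_prod_charEval [Fintype (G →* ℂˣ)] (s : MonoidAlgebra ℤ G) :
    ((LinearMap.det (LinearMap.mulLeft ℤ s) : ℤ) : ℂ) = ∏ χ : G →* ℂˣ, charEval ℤ χ s := by
  classical
  have := Fintype.ofFinite G
  let K : G → Matrix Unit Unit ℂ := fun k => of fun _ _ => ((s.coeff k⁻¹ : ℤ) : ℂ)
  have h := det_groupMatrix K
  have h2 : ((LinearMap.toMatrix (MonoidAlgebra.basis G ℤ) (MonoidAlgebra.basis G ℤ)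
      (LinearMap.mulLeft ℤ s)).map (Int.castRingHom ℂ)).det =
      (of fun a b : Unit × G => K (a.2⁻¹ * b.2) a.1 b.1).det := by
    rw [← det_submatrix_equiv_self (Equiv.punitProd G)]
    congr 1
    ext ⟨-, g⟩ ⟨-, h⟩
    rw [submatrix_apply, map_apply, LinearMap.toMatrix_apply]
    simp [MonoidAlgebra.basis, MonoidAlgebra.coeffLinearEquiv, K,
      MonoidAlgebra.coeff_mul_single_apply, mul_comm]
  rw [← LinearMap.det_toMatrix (MonoidAlgebra.basis G ℤ), ← eq_intCast (Int.castRingHom ℂ),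
    RingHom.map_det, RingHom.mapMatrix_apply, h2, h, ← Equiv.prod_comp (Equiv.inv (G →* ℂˣ))]
  refine Finset.prod_congr rfl fun χ _ => ?_
  rw [det_unique, charEval_apply, Matrix.sum_apply, ← Equiv.sum_comp (Equiv.inv G)]
  refine Finset.sum_congr rfl fun g _ => ?_
  simp [K, mul_comm]

/-- The index of the image of an injective endomorphism of a lattice. -/
theorem card_quotient_range_eq_natAbs_det {M : Type*} [AddCommGroup M] [Module.Free ℤ M]
    [Module.Finite ℤ M] {f : M →ₗ[ℤ] M} (hf : Function.Injective f) :
    f.toAddMonoidHom.range.index = (LinearMap.det f).natAbs :=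
  (Submodule.natAbs_det_equiv (LinearMap.range f) (LinearEquiv.ofInjective f hf)).symm

/-- The norm element, the sum of all the elements of the group. -/
noncomputable def normElement (G : Type*) [Group G] [Finite G] : MonoidAlgebra ℤ G :=
  MonoidAlgebra.ofCoeff (Finsupp.equivFunOnFinite.symm fun _ => 1)

theorem coeff_normElement (g : G) : (normElement G).coeff g = 1 := rfl

theorem charEval_normElement_of_ne_one {χ : G →* ℂˣ} (hχ : χ ≠ 1) :
    charEval ℤ χ (normElement G) = 0 := by
  have := Fintype.ofFinite G
  rw [charEval_apply]
  simp only [coeff_normElement, map_one, one_mul]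
  refine sum_hom_units_eq_zero ((Units.coeHom ℂ).comp χ) fun h => hχ ?_
  ext g
  exact DFunLike.congr_fun h g

theorem lift_one_normElement : MonoidAlgebra.lift ℤ ℤ G 1 (normElement G) = Nat.card G := by
  have := Fintype.ofFinite G
  rw [MonoidAlgebra.lift_apply, Finsupp.sum_fintype _ _ (by simp)]
  simp [coeff_normElement]

theorem mul_normElement (x : MonoidAlgebra ℤ G) :
    x * normElement G = MonoidAlgebra.lift ℤ ℤ G 1 x • normElement G := by
  induction x using MonoidAlgebra.induction_linear with
  | zero => simp
  | add x y hx hy => rw [add_mul, hx, hy, map_add, add_smul]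
  | single g n =>
    ext h
    rw [MonoidAlgebra.coeff_single_mul_apply, MonoidAlgebra.lift_single, coeff_normElement,
      MonoidAlgebra.coeff_smul_apply, coeff_normElement]
    simp

/-- Let `t` in the augmentation ideal `I` be a non-zero-divisor there.  The index of the ideal
generated by `t` is obtained from that of the ideal generated by `s = t + N`, with `N` the norm
element: the index of `s ℤ[G]` is the absolute value of a determinant, while `s ℤ[G] + I` has
index `|G|`, `s ℤ[G] ∩ I = t I`, and `t I` has index `|G|` in `t ℤ[G]`. -/
theorem card_mul_relIndex_span_augmentation [Fintype (G →* ℂˣ)] [DecidableEq (G →* ℂˣ)]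
    {t : MonoidAlgebra ℤ G} (ht : MonoidAlgebra.lift ℤ ℤ G 1 t = 0)
    (hχ : ∀ χ : G →* ℂˣ, χ ≠ 1 → charEval ℤ χ t ≠ 0) :
    (Nat.card G : ℝ) * ((LinearMap.mulLeft ℤ t).toAddMonoidHom.range.relIndex
      (MonoidAlgebra.lift ℤ ℤ G (1 : G →* ℤ)).toRingHom.toAddMonoidHom.ker : ℝ) =
        ‖∏ χ ∈ Finset.univ.erase (1 : G →* ℂˣ), charEval ℤ χ t‖ := by
  set d := Nat.card G with hd
  have hd0 : d ≠ 0 := Nat.card_pos.ne'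
  set N := normElement G
  set ε := (MonoidAlgebra.lift ℤ ℤ G (1 : G →* ℤ)).toRingHom.toAddMonoidHom with hε
  have hεN : ε N = d := lift_one_normElement
  have hεt : ε t = 0 := ht
  have hεmul : ∀ a b, ε (a * b) = ε a * ε b := fun a b => map_mul (MonoidAlgebra.lift ℤ ℤ G 1) a b
  have hNmul : ∀ a, N * a = ε a • N := fun a => (mul_comm N a).trans (mul_normElement a)
  have hsurj : Function.Surjective ε := fun n => ⟨MonoidAlgebra.single 1 n, by simp [hε]⟩
  set μ := (LinearMap.mulLeft ℤ t).toAddMonoidHom with hμ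
  have hμa : ∀ a, μ a = t * a := fun a => rfl
  set s := t + N with hs
  set σ := (LinearMap.mulLeft ℤ s).toAddMonoidHom with hσ
  have hσa : ∀ a, σ a = t * a + ε a • N := fun a => by
    rw [← hNmul, ← add_mul]; rfl
  -- A multiple of an element of the kernel of `t` is a multiple of the norm element.
  have hker : ∀ a, t * a = 0 → (d : ℤ) • a = ε a • N := by
    intro a ha
    have h1 : ∀ χ : G →* ℂˣ, charEval ℤ χ ((d : ℤ) • a - ε a • N) = 0 := by
      intro χ
      rw [map_sub, map_smul, map_smul]
      by_cases h : χ = 1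
      · subst h
        rw [charEval_int_eq_of_one, charEval_int_eq_of_one]
        change (d : ℤ) • ((ε a : ℤ) : ℂ) - ε a • ((ε N : ℤ) : ℂ) = 0
        rw [hεN]
        simp [mul_comm]
      · have h2 := congrArg (charEval ℤ χ) ha
        rw [map_mul, map_zero] at h2
        rw [charEval_normElement_of_ne_one h, (mul_eq_zero.1 h2).resolve_left (hχ χ h)]
        simp
    have h3 : MonoidAlgebra.mapRingHom G (Int.castRingHom ℂ) ((d : ℤ) • a - ε a • N) = 0 :=
      MonoidAlgebra.eq_of_charEval_eq fun χ => by rw [charEval_mapRingHom, h1, map_zero]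
    rw [← sub_eq_zero]
    ext g
    have h4 := DFunLike.congr_fun (congrArg MonoidAlgebra.coeff h3) g
    rw [MonoidAlgebra.coeff_mapRingHom] at h4
    exact Int.cast_injective (α := ℂ) (h4.trans Int.cast_zero.symm)
  have hdvd : ∀ a, t * a = 0 → (d : ℤ) ∣ ε a := by
    intro a ha
    have h1 := DFunLike.congr_fun (congrArg MonoidAlgebra.coeff (hker a ha)) 1
    rw [MonoidAlgebra.coeff_smul_apply, MonoidAlgebra.coeff_smul_apply, coeff_normElement] at h1
    exact ⟨a.coeff 1, by simpa using h1.symm⟩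
  have hindex : ((AddSubgroup.zmultiples (d : ℤ)).comap ε).index = d := by
    rw [AddSubgroup.index_comap_of_surjective _ hsurj, Int.index_zmultiples, Int.natAbs_natCast]
  have hmem : ∀ a, a ∈ (AddSubgroup.zmultiples (d : ℤ)).comap ε ↔ (d : ℤ) ∣ ε a := fun a => by
    rw [AddSubgroup.mem_comap, Int.mem_zmultiples_iff]
  -- The first two indices.
  have hsup : ε.ker ⊔ σ.range = (AddSubgroup.zmultiples (d : ℤ)).comap ε := by
    refine le_antisymm (sup_le ?_ ?_) fun a ha => ?_
    · intro a ha
      rw [hmem, AddMonoidHom.mem_ker.1 ha]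
      exact dvd_zero _
    · rintro _ ⟨a, rfl⟩
      rw [hmem, hσa, map_add, hεmul, hεt, zero_mul, zero_add, map_zsmul, hεN]
      exact ⟨ε a, by simp [mul_comm]⟩
    · obtain ⟨k, hk⟩ := (hmem a).1 ha
      have h1 : ε (σ (k • 1)) = ε a := by
        rw [hσa, map_add, hεmul, hεt, zero_mul, zero_add, map_zsmul, map_zsmul, hεN, hk]
        have : ε 1 = 1 := map_one (MonoidAlgebra.lift ℤ ℤ G 1)
        rw [this]
        simp [mul_comm]
      rw [← sub_add_cancel a (σ (k • 1))]
      refine AddSubgroup.add_mem_sup ?_ ⟨_, rfl⟩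
      rw [AddMonoidHom.mem_ker, map_sub, h1, sub_self]
  have hinf : σ.range ⊓ ε.ker = ε.ker.map μ := by
    ext b
    constructor
    · rintro ⟨⟨a, rfl⟩, hb⟩
      have hb' : ε (σ a) = 0 := hb
      rw [hσa, map_add, hεmul, hεt, zero_mul, zero_add, map_zsmul, hεN] at hb'
      have ha : ε a = 0 := by simpa [hd0] using hb'
      exact ⟨a, ha, by rw [hσa, hμa, ha, zero_smul, add_zero]⟩
    · rintro ⟨a, ha, rfl⟩
      have ha' : ε a = 0 := ha
      refine ⟨⟨a, by rw [hσa, hμa, ha', zero_smul, add_zero]⟩, ?_⟩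
      change ε (t * a) = 0
      rw [hεmul, hεt, zero_mul]
  -- The index of `t I` in `t ℤ[G]`.
  have hsup2 : ε.ker ⊔ μ.ker = (AddSubgroup.zmultiples (d : ℤ)).comap ε := by
    refine le_antisymm (sup_le ?_ ?_) fun a ha => ?_
    · intro a ha
      rw [hmem, AddMonoidHom.mem_ker.1 ha]
      exact dvd_zero _
    · intro a ha
      rw [hmem]
      exact hdvd a ha
    · obtain ⟨k, hk⟩ := (hmem a).1 ha
      rw [← sub_add_cancel a (k • N)]
      refine AddSubgroup.add_mem_sup ?_ ?_
      · rw [AddMonoidHom.mem_ker, map_sub, map_zsmul, hεN, hk]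
        simp [mul_comm]
      · change t * (k • N) = 0
        rw [mul_smul_comm, mul_comm t, hNmul, hεt, zero_smul, smul_zero]
  have htI : (ε.ker.map μ).relIndex μ.range = d := by
    rw [AddMonoidHom.range_eq_map, AddSubgroup.relIndex_map_map, hsup2, top_sup_eq,
      AddSubgroup.relIndex_top_right, hindex]
  have hle1 : ε.ker.map μ ≤ μ.range := by
    rintro _ ⟨a, -, rfl⟩
    exact ⟨a, rfl⟩
  have hle2 : μ.range ≤ ε.ker := by
    rintro _ ⟨a, rfl⟩
    change ε (t * a) = 0
    rw [hεmul, hεt, zero_mul]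
  have htotal : σ.range.index = d * μ.range.relIndex ε.ker * d := by
    rw [← AddSubgroup.relIndex_mul_index (le_sup_right : σ.range ≤ ε.ker ⊔ σ.range),
      AddSubgroup.relIndex_sup_right, hsup, hindex, ← AddSubgroup.inf_relIndex_right, hinf,
      ← AddSubgroup.relIndex_mul_relIndex _ _ _ hle1 hle2, htI]
  -- The determinant of the multiplication by `s`.
  have hprod : ∏ χ : G →* ℂˣ, charEval ℤ χ s =
      d * ∏ χ ∈ Finset.univ.erase (1 : G →* ℂˣ), charEval ℤ χ t := by
    rw [← Finset.mul_prod_erase _ _ (Finset.mem_univ (1 : G →* ℂˣ))]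
    congr 1
    · rw [charEval_int_eq_of_one]
      change ((ε s : ℤ) : ℂ) = d
      rw [hs, map_add, hεt, hεN]
      simp
    · refine Finset.prod_congr rfl fun χ h => ?_
      rw [hs, map_add, charEval_normElement_of_ne_one (Finset.ne_of_mem_erase h), add_zero]
  have hdet := det_mulLeft_eq_prod_charEval s
  rw [hprod] at hdet
  have hdet0 : LinearMap.det (LinearMap.mulLeft ℤ s) ≠ 0 := by
    intro h
    rw [h, Int.cast_zero, eq_comm, mul_eq_zero, Finset.prod_eq_zero_iff] at hdet
    rcases hdet with h | ⟨χ, h, h'⟩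
    · exact hd0 (by exact_mod_cast h)
    · exact hχ χ (Finset.ne_of_mem_erase h) h'
  have hinj : Function.Injective (LinearMap.mulLeft ℤ s) :=
    LinearMap.ker_eq_bot.1 (by_contra fun h => hdet0 (LinearMap.det_eq_zero_iff_ker_ne_bot.2 h))
  have hcard := card_quotient_range_eq_natAbs_det hinj
  have hnorm := congrArg (‖·‖) hdet
  simp only [norm_mul, Complex.norm_natCast, Complex.norm_intCast] at hnorm
  have hreal : ((LinearMap.det (LinearMap.mulLeft ℤ s)).natAbs : ℝ) =
      |((LinearMap.det (LinearMap.mulLeft ℤ s) : ℤ) : ℝ)| := by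
    rw [Nat.cast_natAbs, Int.cast_abs]
  rw [← hreal, ← hcard, ← hσ, htotal] at hnorm
  push_cast at hnorm
  have hd0' : (d : ℝ) ≠ 0 := by exact_mod_cast hd0
  refine mul_left_cancel₀ hd0' ?_
  rw [← hnorm]
  ring

end GroupRing

/-! ### Special values -/

namespace Multigraph

section Valency

variable {V D : Type*} (X : Multigraph V D)

theorem sum_valency [Fintype V] [Finite D] : ∑ v, X.valency v = Nat.card D := by
  classical
  have := Fintype.ofFinite D
  rw [Nat.card_eq_fintype_card, ← Finset.card_univ,
    Finset.card_eq_sum_card_fiberwise (f := X.init) (t := Finset.univ) (by simp)]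
  refine Finset.sum_congr rfl fun v _ => ?_
  rw [valency, Nat.card_eq_fintype_card, Fintype.card_subtype]

/-- A connected multigraph without vertices of valency one has at least as many edges as vertices,
unless it is a point. -/
theorem card_le_card_edge_or_isEmpty [Finite V] [Finite D] (hX : X.Connected)
    (hX1 : ∀ v, X.valency v ≠ 1) : Nat.card V ≤ Nat.card X.Edge ∨ IsEmpty D := by
  have := Fintype.ofFinite V
  by_cases h : ∃ v, X.valency v = 0
  · right
    obtain ⟨v, hv⟩ := h
    have hv' : IsEmpty {e : D // X.init e = v} := (Nat.card_eq_zero.1 hv).resolve_right fun h =>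
      h.not_finite inferInstance
    refine ⟨fun e => ?_⟩
    obtain ⟨p, hp⟩ := hX.2 v (X.init e)
    cases p with
    | nil => exact hv'.false ⟨e, hp.symm⟩
    | cons f p => exact hv'.false ⟨f, hp.1⟩
  · left
    push Not at h
    have h2 : ∑ _v : V, 2 ≤ ∑ v, X.valency v := Finset.sum_le_sum fun v _ => by
      have := h v; have := hX1 v; omega
    rw [X.sum_valency, X.card_eq_two_mul_card_edge, Finset.sum_const, smul_eq_mul,
      Finset.card_univ, ← Nat.card_eq_fintype_card] at h2
    omega

end Valency

section SpecialValue

open Polynomial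

variable {V D : Type*} [Fintype D] [DecidableEq D] [DecidableEq V] (X : Multigraph V D)

/-- The polynomial `det (1 - u W)`, where `W` is the edge matrix with weights `c`. -/
noncomputable def edgePolynomial (c : D → ℂ) : ℂ[X] :=
  (1 - (Polynomial.X : ℂ[X]) • X.edgeMatrix fun e => C (c e)).det

theorem edgePolynomial_eval_zero (c : D → ℂ) : (X.edgePolynomial c).eval 0 = 1 := by
  rw [edgePolynomial, ← coe_evalRingHom, RingHom.map_det]
  convert det_one (n := D) (R := ℂ)
  ext i j
  by_cases hij : i = j
  · subst hij; simp
  · simp [hij]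

theorem edgePolynomial_ne_zero (c : D → ℂ) : X.edgePolynomial c ≠ 0 := fun h => by
  have := X.edgePolynomial_eval_zero c
  simp [h] at this

theorem coe_edgePolynomial (c : D → ℂ) :
    (X.edgePolynomial c : PowerSeries ℂ) =
      (1 - (PowerSeries.X : PowerSeries ℂ) • (X.edgeMatrix c).map PowerSeries.C).det := by
  rw [edgePolynomial, ← coeToPowerSeries.ringHom_apply, RingHom.map_det]
  congr 1
  ext1 i j
  simp only [RingHom.mapMatrix_apply, map_apply, Matrix.sub_apply, Matrix.smul_apply, edgeMatrix,
    of_apply, smul_eq_mul, map_sub, map_mul, coeToPowerSeries.ringHom_apply, coe_X, one_apply]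
  split_ifs <;> simp

variable [Fintype V]

/-- The leading Taylor coefficient of `det (1 - u W)` at `u = 1`, by Bass's formula: the vertex
matrix specialises to the twisted Laplacian. -/
theorem trailingCoeff_taylor_edgePolynomial {c : D → ℂ} (hc : ∀ e, c e * c (X.rev e) = 1)
    (hVE : Nat.card V ≤ Nat.card X.Edge) (h0 : (X.twistedLaplacian c).det ≠ 0) :
    (taylor 1 (X.edgePolynomial c)).trailingCoeff =
      (-2) ^ (Nat.card X.Edge - Nat.card V) * (X.twistedLaplacian c).det := by
  have hB := X.det_one_sub_X_smul_edgeMatrix (c := fun e => C (c e)) (K := ℂ)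
    fun e => by rw [← C_mul, hc, C_1]
  set P := (X.vertexMatrix (fun e => C (c e)) Polynomial.X).det with hP
  have hfac : X.edgePolynomial c =
      (1 - Polynomial.X ^ 2) ^ (Nat.card X.Edge - Nat.card V) * P := by
    refine mul_left_cancel₀ (pow_ne_zero (Nat.card V) one_sub_X_sq_ne_zero) ?_
    rw [← mul_assoc, ← pow_add, Nat.add_sub_cancel' hVE]
    exact hB
  have hP1 : P.eval 1 = (X.twistedLaplacian c).det := by
    rw [← vertexMatrix_one, hP, ← coe_evalRingHom, RingHom.map_det]
    congr 1
    ext v w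
    simp only [RingHom.mapMatrix_apply, map_apply, vertexMatrix, Matrix.add_apply, of_apply,
      map_add, map_sum, map_sub]
    congr 1
    · by_cases h : v = w <;> simp [h]
    · refine Finset.sum_congr rfl fun e _ => ?_
      congr 1 <;> split_ifs <;> simp
  have htr : (taylor 1 P).trailingCoeff = (X.twistedLaplacian c).det := by
    have hc0 : (taylor 1 P).coeff 0 = (X.twistedLaplacian c).det := by rw [taylor_coeff_zero, hP1]
    rw [trailingCoeff, natTrailingDegree_eq_zero.2 (Or.inr (by rwa [hc0])), hc0]
  -- At `u = 1` the factor `1 - u²` is `-(u - 1) (2 + (u - 1))`.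
  have hu : taylor 1 (1 - Polynomial.X ^ 2 : ℂ[X]) = Polynomial.X * (-(Polynomial.X + C 2)) := by
    rw [map_sub, taylor_one, taylor_pow, taylor_X, C_1, show (C 2 : ℂ[X]) = 2 from C_ofNat 2]
    ring
  have hu2 : (taylor 1 (1 - Polynomial.X ^ 2 : ℂ[X])).trailingCoeff = -2 := by
    rw [hu, trailingCoeff_mul]
    have h1 : (Polynomial.X : ℂ[X]).trailingCoeff = 1 := by
      simp [trailingCoeff]
    have h2 : (-(Polynomial.X + C 2) : ℂ[X]).coeff 0 = -2 := by simp
    rw [h1, one_mul, trailingCoeff, natTrailingDegree_eq_zero.2 (Or.inr (by rw [h2]; norm_num)), h2]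
  have hpow : ∀ n : ℕ, ((taylor 1 (1 - Polynomial.X ^ 2 : ℂ[X])) ^ n).trailingCoeff = (-2) ^ n := by
    intro n
    induction n with
    | zero => simp [trailingCoeff]
    | succ n ih => rw [pow_succ, trailingCoeff_mul, ih, hu2, pow_succ]
  rw [hfac, taylor_mul, taylor_pow, trailingCoeff_mul, hpow, htr]

end SpecialValue

namespace Hom

namespace Voltage

open scoped PowerSeries.WithPiTopology PowerSeries

variable {W F V D : Type*} {Y : Multigraph W F} {X : Multigraph V D} {π : Y.Hom X}
  (A : π.Voltage) [Fintype D] [DecidableEq D] [DecidableEq V]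

theorem hasProd_eulerFactor (hπ : π.IsGalois) (hG : ∀ σ τ : π.aut, σ * τ = τ * σ)
    (χ : π.aut →* ℂˣ) :
    HasProd (π.eulerFactor χ) (X.edgePolynomial (A.charWeight χ) : ℂ⟦X⟧)⁻¹ := by
  have h := X.hasProd_euler fun e => χ (A.volt e)
  rw [coe_edgePolynomial]
  convert h using 2 with P
  · rw [eulerFactor]
    congr 4
    obtain ⟨p, rfl⟩ := Quotient.exists_rep P
    rw [← A.frobenius_eq hπ hG _ p rfl, map_list_prod, List.map_map]
    rfl
  · rfl

theorem inv_LFunction (hπ : π.IsGalois) (hG : ∀ σ τ : π.aut, σ * τ = τ * σ) (χ : π.aut →* ℂˣ) :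
    (π.LFunction χ)⁻¹ = (X.edgePolynomial (A.charWeight χ) : ℂ⟦X⟧) := by
  have h0 : PowerSeries.constantCoeff (X.edgePolynomial (A.charWeight χ) : ℂ⟦X⟧) ≠ 0 := by
    rw [Polynomial.constantCoeff_coe, Polynomial.coeff_zero_eq_eval_zero,
      edgePolynomial_eval_zero]
    exact one_ne_zero
  rw [LFunction, (A.hasProd_eulerFactor hπ hG χ).tprod_eq, eq_comm,
    PowerSeries.eq_inv_iff_mul_eq_one, PowerSeries.mul_inv_cancel _ h0]
  rw [PowerSeries.constantCoeff_inv]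
  exact inv_ne_zero h0

theorem specialValue_eq [Fintype V] (hπ : π.IsGalois) (hG : ∀ σ τ : π.aut, σ * τ = τ * σ)
    (hVE : Nat.card V ≤ Nat.card X.Edge) {χ : π.aut →* ℂˣ}
    (h0 : (X.twistedLaplacian (A.charWeight χ)).det ≠ 0) :
    π.specialValue χ =
      (-2) ^ (Nat.card X.Edge - Nat.card V) * (X.twistedLaplacian (A.charWeight χ)).det := by
  have hex : ∃ Q : Polynomial ℂ, (Q : ℂ⟦X⟧) = (π.LFunction χ)⁻¹ :=
    ⟨_, (A.inv_LFunction hπ hG χ).symm⟩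
  have hQ : hex.choose = X.edgePolynomial (A.charWeight χ) :=
    Polynomial.coe_injective ℂ (hex.choose_spec.trans (A.inv_LFunction hπ hG χ))
  rw [specialValue, dif_pos hex, hQ,
    X.trailingCoeff_taylor_edgePolynomial (A.charWeight_mul_rev χ) hVE h0]

end Voltage

end Hom

end Multigraph

/-! ### The equivariant special value -/

namespace Multigraph

namespace Hom

variable {W F V D : Type*} {Y : Multigraph W F} {X : Multigraph V D} {π : Y.Hom X}

open Classical in
theorem charEval_idem [Finite π.aut] (ψ χ : π.aut →* ℂˣ) :
    charEval ℂ ψ (π.idem χ) = if ψ = χ then 1 else 0 := by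
  have := Fintype.ofFinite π.aut
  rw [idem, map_smul, finsum_eq_sum_of_fintype, map_sum]
  simp only [charEval_single, Algebra.algebraMap_self, RingHom.id_apply, smul_eq_mul]
  by_cases h : ψ = χ
  · subst h
    rw [if_pos rfl]
    have h1 : ∀ σ : π.aut, (ψ σ : ℂ) * (ψ σ⁻¹ : ℂ) = 1 := fun σ => by
      rw [← Units.val_mul, ← map_mul, mul_inv_cancel, map_one, Units.val_one]
    have h2 : (Nat.card π.aut : ℂ) ≠ 0 := by exact_mod_cast Nat.card_pos.ne'
    simp only [h1, Finset.sum_const, Finset.card_univ, ← Nat.card_eq_fintype_card, nsmul_eq_mul,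
      mul_one]
    exact inv_mul_cancel₀ h2
  · rw [if_neg h]
    have h1 : ∑ σ, ((Units.coeHom ℂ).comp (χ * ψ⁻¹)) σ = 0 := by
      refine sum_hom_units_eq_zero _ fun h1 => h ?_
      have h2 : χ * ψ⁻¹ = 1 := by
        ext g
        exact DFunLike.congr_fun h1 g
      exact (mul_inv_eq_one.1 h2).symm
    have h2 : ∀ σ : π.aut, (χ σ : ℂ) * (ψ σ⁻¹ : ℂ) = ((Units.coeHom ℂ).comp (χ * ψ⁻¹)) σ := by
      intro σ
      rw [map_inv]
      rfl
    simp only [h2, h1, mul_zero]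

theorem charEval_theta [Finite π.aut] [Finite (π.aut →* ℂˣ)] (ψ : π.aut →* ℂˣ) :
    charEval ℂ ψ π.theta = π.specialValue ψ⁻¹ := by
  classical
  have := Fintype.ofFinite (π.aut →* ℂˣ)
  rw [theta, finsum_eq_sum_of_fintype, map_sum]
  simp only [map_smul, charEval_idem, smul_eq_mul, mul_ite, mul_one, mul_zero]
  rw [Finset.sum_eq_single ψ⁻¹ (fun χ _ h => if_neg fun h' => h ?_) (by simp),
    if_pos (inv_inv ψ).symm]
  rw [h']
  exact (inv_inv χ).symm

theorem charEval_theta_mul [Finite π.aut] [Finite (π.aut →* ℂˣ)] (ψ : π.aut →* ℂˣ) :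
    charEval ℂ ψ (π.theta * (1 - π.idem 1)) =
      open Classical in if ψ = 1 then 0 else π.specialValue ψ⁻¹ := by
  rw [map_mul, map_sub, map_one, charEval_idem, charEval_theta]
  split_ifs <;> simp

namespace Voltage

variable (A : π.Voltage) [Fintype D] [DecidableEq V]

theorem charEval_det_twistedLaplacian [Fintype V] {G : Type*} [CommGroup G] (ψ : G →* ℂˣ)
    (α : D → G) : charEval ℤ ψ (X.twistedLaplacian fun e =>
      (MonoidAlgebra.single (α e) 1 : MonoidAlgebra ℤ G)).det =
        (X.twistedLaplacian fun e => (ψ (α e) : ℂ)).det := by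
  rw [← AlgHom.coe_toRingHom, RingHom.map_det, RingHom.mapMatrix_apply, map_twistedLaplacian]
  simp [charEval_single]

theorem det_twistedLaplacian_ne_zero [Fintype V] [Finite W] [Finite F] (hπ : π.IsCovering)
    (hG : ∀ σ τ : π.aut, σ * τ = τ * σ) [Finite π.aut] [Finite (π.aut →* ℂˣ)]
    (hX : X.Connected) (hY : Y.Connected) {χ : π.aut →* ℂˣ} (hχ : χ ≠ 1) :
    (X.twistedLaplacian (A.charWeight χ)).det ≠ 0 := by
  classical
  have := Fintype.ofFinite (π.aut →* ℂˣ)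
  have := Fintype.ofFinite F
  have := hX.1
  have := hY.1
  have h := A.card_mul_numSpanningTrees hπ hG
  have h1 : (Nat.card W : ℂ) * Y.numSpanningTrees ≠ 0 :=
    mul_ne_zero (by exact_mod_cast Nat.card_pos.ne')
      (by exact_mod_cast (Y.numSpanningTrees_pos hY).ne')
  rw [h] at h1
  exact Finset.prod_ne_zero_iff.1 (right_ne_zero_of_mul h1) χ (by simp [hχ])

end Voltage

/-- A cover of a point is trivial. -/
theorem aut_subsingleton_of_isEmpty [IsEmpty D] (hπ : π.IsCovering) (hY : Y.Connected) :
    Subsingleton π.aut := by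
  have hF : IsEmpty F := ⟨fun f => IsEmpty.false (π.onDart f)⟩
  obtain ⟨w⟩ := hY.1
  have hw : ∀ w', w = w' := fun w' => by
    obtain ⟨p, hp⟩ := hY.2 w w'
    cases p with
    | nil => exact hp
    | cons f p => exact (hF.false f).elim
  refine ⟨fun g h => ?_⟩
  rw [hπ.aut_eq_one hY (hw (g.1.1 w)).symm, hπ.aut_eq_one hY (hw (h.1.1 w)).symm]

end Hom

end Multigraph

theorem character_inv_eq_one {G : Type*} [Group G] {χ : G →* ℂˣ} : χ⁻¹ = 1 ↔ χ = 1 := by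
  constructor
  · intro h
    ext g
    have := DFunLike.congr_fun h g
    rw [MonoidHom.inv_apply, MonoidHom.one_apply, inv_eq_one] at this
    rw [this, MonoidHom.one_apply]
  · rintro rfl
    ext g
    rw [MonoidHom.inv_apply, MonoidHom.one_apply, inv_one]

open Multigraph in
open scoped PowerSeries.WithPiTopology in
theorem mainTheorem2 {V D W F : Type*} [Finite V] [Finite D] [Finite W] [Finite F]
    (X : Multigraph V D) (Y : Multigraph W F)
    (hX : X.Connected) (hY : Y.Connected)
    (hX1 : ∀ v, X.valency v ≠ 1)
    (π : Y.Hom X) (hπ : π.IsGalois)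
    (hG : ∀ σ τ : π.aut, σ * τ = τ * σ)
    (d : ℕ) (hd : π.HasDegree d) :
    (∀ χ : π.aut →* ℂˣ, π.EulerProductConverges χ ∧
      ∃ Q : Polynomial ℂ, Q ≠ 0 ∧ (Q : PowerSeries ℂ) = (π.LFunction χ)⁻¹) ∧
    ∃ t : MonoidAlgebra ℤ π.aut,
      MonoidAlgebra.mapRingHom π.aut (Int.castRingHom ℂ) t = π.theta * (1 - π.idem 1) ∧
      t ∈ π.augIdeal ∧
      Finite (π.augIdeal ⧸ Submodule.submoduleOf (Ideal.span {t}) π.augIdeal) ∧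
      (Nat.card (π.augIdeal ⧸ Submodule.submoduleOf (Ideal.span {t}) π.augIdeal) : ℚ) =
        (2 : ℚ) ^ (((d : ℤ) - 1) * (X.rank - 1)) *
          ((Y.numSpanningTrees : ℚ) / (X.numSpanningTrees : ℚ)) := by
  classical
  have := Fintype.ofFinite V
  have := Fintype.ofFinite D
  have := Fintype.ofFinite F
  have := hX.1
  obtain ⟨A⟩ := hπ.nonempty_voltage hY
  have hcard : Nat.card π.aut = d := A.card_aut hd hX.1
  let _ : CommGroup π.aut := { (inferInstance : Group π.aut) with mul_comm := hG }
  have hchar : Finite (π.aut →* ℂˣ) := finite_characters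
  have := Fintype.ofFinite (π.aut →* ℂˣ)
  have hncard : Fintype.card (π.aut →* ℂˣ) = d := by
    rw [← hcard, ← Nat.card_eq_fintype_card]
    exact card_characters
  refine ⟨fun χ => ⟨(A.hasProd_eulerFactor hπ hG χ).multipliable, _,
    X.edgePolynomial_ne_zero _, (A.inv_LFunction hπ hG χ).symm⟩, ?_⟩
  have hdet : ∀ χ : π.aut →* ℂˣ, χ ≠ 1 → (X.twistedLaplacian (A.charWeight χ)).det ≠ 0 :=
    fun χ hχ => A.det_twistedLaplacian_ne_zero hπ.1 hG hX hY hχ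
  -- Either the graph has at least as many edges as vertices, or the cover is trivial.
  have hcase : Nat.card V ≤ Nat.card X.Edge ∨ d = 1 := by
    rcases X.card_le_card_edge_or_isEmpty hX hX1 with h | h
    · exact Or.inl h
    · have := Hom.aut_subsingleton_of_isEmpty hπ.1 hY
      exact Or.inr (hcard ▸ Nat.card_unique)
  set k := Nat.card X.Edge - Nat.card V with hk
  set t : MonoidAlgebra ℤ π.aut := (-2) ^ k * (X.twistedLaplacian fun e =>
    (MonoidAlgebra.single (A.volt e)⁻¹ 1 : MonoidAlgebra ℤ π.aut)).det with ht
  have htχ : ∀ χ : π.aut →* ℂˣ,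
      charEval ℤ χ t = (-2) ^ k * (X.twistedLaplacian (A.charWeight χ⁻¹)).det := by
    intro χ
    rw [ht, map_mul, map_pow, map_neg, map_ofNat, Hom.Voltage.charEval_det_twistedLaplacian]
    congr 3
    funext e
    rw [map_inv]
    rfl
  have ht1 : charEval ℤ (1 : π.aut →* ℂˣ) t = 0 := by
    rw [htχ, show (1 : π.aut →* ℂˣ)⁻¹ = 1 from character_inv_eq_one.2 rfl, A.charWeight_one, det_twistedLaplacian_one, mul_zero]
  have hε : MonoidAlgebra.lift ℤ ℤ π.aut 1 t = 0 := by
    have := charEval_int_eq_of_one t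
    rw [ht1] at this
    exact_mod_cast this.symm
  have hχt : ∀ χ : π.aut →* ℂˣ, χ ≠ 1 → charEval ℤ χ t ≠ 0 := fun χ hχ => by
    rw [htχ]
    exact mul_ne_zero (pow_ne_zero _ (by norm_num)) (hdet _ fun h => hχ (character_inv_eq_one.1 h))
  have hindex := card_mul_relIndex_span_augmentation hε hχt
  have hquot : Nat.card (π.augIdeal ⧸ Submodule.submoduleOf (Ideal.span {t}) π.augIdeal) =
      (LinearMap.mulLeft ℤ t).toAddMonoidHom.range.relIndex
        (MonoidAlgebra.lift ℤ ℤ π.aut (1 : π.aut →* ℤ)).toRingHom.toAddMonoidHom.ker := by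
    have h1 : (Ideal.span {t}).toAddSubgroup = (LinearMap.mulLeft ℤ t).toAddMonoidHom.range := by
      ext x
      rw [Submodule.mem_toAddSubgroup, Ideal.mem_span_singleton']
      exact ⟨fun ⟨a, ha⟩ => ⟨a, (mul_comm t a).trans ha⟩, fun ⟨a, ha⟩ => ⟨a, (mul_comm a t).trans ha⟩⟩
    rw [← h1]
    rfl
  rw [hcard, ← hquot] at hindex
  -- The product of the special values at the non-trivial characters.
  have hprod : ∏ χ ∈ Finset.univ.erase (1 : π.aut →* ℂˣ), charEval ℤ χ t =
      ((-2) ^ k) ^ (d - 1) * ∏ χ ∈ Finset.univ.erase (1 : π.aut →* ℂˣ),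
        (X.twistedLaplacian (A.charWeight χ)).det := by
    simp only [htχ]
    rw [Finset.prod_mul_distrib, Finset.prod_const, Finset.card_erase_of_mem (Finset.mem_univ _),
      Finset.card_univ, hncard]
    congr 1
    refine Finset.prod_bij (fun χ _ => χ⁻¹) (fun χ h => ?_) (fun χ _ χ' _ h => inv_injective h)
      (fun χ h => ⟨χ⁻¹, ?_, inv_inv χ⟩) fun χ _ => rfl
    · exact Finset.mem_erase.2 ⟨fun h' => (Finset.mem_erase.1 h).1 (character_inv_eq_one.1 h'),
        Finset.mem_univ _⟩
    · exact Finset.mem_erase.2 ⟨fun h' => (Finset.mem_erase.1 h).1 (character_inv_eq_one.1 h'),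
        Finset.mem_univ _⟩
  have hκ := congrArg (‖·‖) (A.card_mul_numSpanningTrees hπ.1 hG)
  have hW : Nat.card W = Nat.card V * d := by
    rw [← Nat.card_congr A.triv, Nat.card_prod, hcard]
  rw [hprod] at hindex
  simp only [norm_mul, norm_pow, norm_neg, Complex.norm_natCast, Complex.norm_ofNat, hW,
    Nat.cast_mul] at hκ hindex
  set ρ := ‖∏ χ ∈ Finset.univ.erase (1 : π.aut →* ℂˣ), (X.twistedLaplacian (A.charWeight χ)).det‖
  set m := Nat.card (π.augIdeal ⧸ Submodule.submoduleOf (Ideal.span {t}) π.augIdeal)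
  have hV0 : (Nat.card V : ℝ) ≠ 0 := by exact_mod_cast Nat.card_pos.ne'
  have hd0 : d ≠ 0 := hcard ▸ Nat.card_pos.ne'
  have hd0' : (d : ℝ) ≠ 0 := by exact_mod_cast hd0
  have hκX := X.numSpanningTrees_pos hX
  have hκY := Y.numSpanningTrees_pos hY
  have hmul : m * X.numSpanningTrees = 2 ^ (k * (d - 1)) * Y.numSpanningTrees := by
    have h1 : ((m * X.numSpanningTrees : ℕ) : ℝ) =
        ((2 ^ (k * (d - 1)) * Y.numSpanningTrees : ℕ) : ℝ) := by
      push_cast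
      rw [pow_mul]
      refine mul_left_cancel₀ (mul_ne_zero hV0 hd0') ?_
      linear_combination (Nat.card V : ℝ) * X.numSpanningTrees * hindex - (2 ^ k) ^ (d - 1) * hκ
    exact_mod_cast h1
  have hm0 : m ≠ 0 := by
    rintro h
    rw [h, zero_mul] at hmul
    exact (Nat.mul_pos (by positivity) hκY).ne hmul
  refine ⟨t, MonoidAlgebra.eq_of_charEval_eq fun χ => ?_, hε, Nat.finite_of_card_ne_zero hm0, ?_⟩
  · rw [charEval_mapRingHom, Hom.charEval_theta_mul]
    split_ifs with h
    · rw [h, ht1]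
    · have hχ : χ⁻¹ ≠ 1 := fun h' => h (character_inv_eq_one.1 h')
      rcases hcase with hVE | hd1
      · rw [htχ, A.specialValue_eq hπ hG hVE (hdet _ hχ)]
      · rw [hd1] at hncard
        have := Fintype.card_le_one_iff_subsingleton.1 hncard.le
        exact absurd (Subsingleton.elim _ _) h
  · have hexp : ((d : ℤ) - 1) * (X.rank - 1) = ((k * (d - 1) : ℕ) : ℤ) := by
      unfold Multigraph.rank
      rcases hcase with hVE | hd1
      · rw [hk]
        push_cast [Nat.cast_sub hVE, Nat.cast_sub (Nat.one_le_iff_ne_zero.2 hd0)]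
        ring
      · simp [hd1]
    rw [hexp, zpow_natCast, ← mul_div_assoc, eq_div_iff (by exact_mod_cast hκX.ne')]
    exact_mod_cast hmul
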